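/- Let $X,X'$ have law $P$ and $Y,Y'$ have law $Q$ on $\mathbb{R}^d$, all independent, with finite third moments, and let $$\mathcal D^2(X,Y)=\mathbb E\|X-Y\|-\tfrac12\mathbb E\|X-X'\|-\tfrac12\mathbb E\|Y-Y'\|$$ be the squared energy distance. Write $\mu=\mathbb E X-\mathbb E Y$, $\Delta=\mathrm{Cov}(X)-\mathrm{Cov}(Y)$, let $\kappa_{ijk}$ be the difference of the third central moments of $X$ and $Y$, $$\kappa_{ijk}=\mathbb E\big[(X_i-\mathbb EX_i)(X_j-\mathbb EX_j)(X_k-\mathbb EX_k)\big]-\mathbb E\big[(Y_i-\mathbb EY_i)(Y_j-\mathbb EY_j)(Y_k-\mathbb EY_k)\big],$$ and put $\beta\cdot\mu=\sum_{i,j=1}^d\kappa_{iij}\mu_j$. There are real sequences $\varepsilon_1(d),\varepsilon_2(d)=O(1/d)$ as $d\to\infty$, depending on nothing but $d$, such that the following holds. Let $d>1$, let $H:\mathbb R^d\to\mathbb R$ be spherically symmetric, $H(\omega)=h(\|\omega\|)$, let $B:\mathbb R\to[0,\infty)$, $0<b<1$ and $K\in\mathbb R$. Then there is a constant $C>0$,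 depending only on these data and in particular not on $\lambda$, such that for every $\lambda>0$ and all $X,Y$ as above (which may depend on $\lambda$) satisfying (a) the characteristic functions of $X$ and $Y$ have the form $e^{U}$ and $e^{V}$, and $\tilde H(\omega):=\big|e^{(U(\omega)+V(\omega))/2}\big|^2=H(\lambda\omega)$ for all $\omega$; (b) with $W=U-V$, the functions $e^{W}$ and $e^{-W}$ are $C^5$, and $\|e^{W}\|_{C^5_r}+\|e^{-W}\|_{C^5_r}\le B(r)$ for all $r\ge0$, where $\|f\|_{C^5_r}=\sup_{\|\omega\|\le r}\sum_{|\alpha|\le5}|\partial^\alpha f(\omega)|$; (c) $\displaystyle\int_{\mathbb R^d}\frac{H(\lambda\omega)}{\|\omega\|^{d+1}}\|\omega\|^5B(\|\omega\|)\,d\omega\le\frac{K}{\lambda^{4-b}}$, the integrals $\int_0^\infty h(r)\,dr$ and $\int_0^\infty h(r)r^2\,dr$ converge absolutely and $$\mathcal D^2(X,Y)=\frac1\lambda\frac{1+\varepsilon_1(d)}{\sqrt{2\pi d}}\|\mu\|^2\int_0^\infty h(r)\,dr+\frac1{\lambda^3}\frac{1}{4d}\frac{1+\varepsilon_2(d)}{\sqrt{2\pi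 d}}\Big[2\|\Delta\|_F^2+\mathrm{Tr}(\Delta)^2-\|\mu\|^4-4\beta\cdot\mu\Big]\int_0^\infty h(r)r^2\,dr+R,$$ $$|R|\le\frac{C}{\lambda^{4-b}}.$$ -/

import Mathlib

open scoped NNReal ENNReal

noncomputable section

namespace EnergyDist

/-- The space `ℝ^d` with its Euclidean norm. -/
abbrev Vec (d : ℕ) : Type := EuclideanSpace ℝ (Fin d)

/-- The squared energy distance
`E‖X - Y‖ - (1/2) E‖X - X'‖ - (1/2) E‖Y - Y'‖`, where `X, X'` have law `P`, `Y, Y'` have law `Q`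
and all four are independent. -/
def energyDistSq {d : ℕ} (P Q : MeasureTheory.Measure (Vec d)) : ℝ :=
  (∫ z, ‖z.1 - z.2‖ ∂(P.prod Q)) - (1 / 2) * (∫ z, ‖z.1 - z.2‖ ∂(P.prod P))
    - (1 / 2) * (∫ z, ‖z.1 - z.2‖ ∂(Q.prod Q))

/-- The mean of the law `P`. -/
def mean {d : ℕ} (P : MeasureTheory.Measure (Vec d)) : Vec d := ∫ x, x ∂P

/-- The covariance matrix of the law `P`. -/
def covMatrix {d : ℕ} (P : MeasureTheory.Measure (Vec d)) : Matrix (Fin d) (Fin d) ℝ :=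
  Matrix.of fun i j => ∫ x, (x i - mean P i) * (x j - mean P j) ∂P

/-- The third central moments of the law `P`. -/
def thirdCentralMoment {d : ℕ} (P : MeasureTheory.Measure (Vec d)) (i j k : Fin d) : ℝ :=
  ∫ x, (x i - mean P i) * (x j - mean P j) * (x k - mean P k) ∂P

/-- The difference of means `μ = E X - E Y`. -/
def meanDiff {d : ℕ} (P Q : MeasureTheory.Measure (Vec d)) : Vec d := mean P - mean Q

/-- The difference of covariances `Δ = Cov X - Cov Y`. -/
def covDiff {d : ℕ} (P Q : MeasureTheory.Measure (Vec d)) : Matrix (Fin d) (Fin d) ℝ :=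
  covMatrix P - covMatrix Q

/-- The difference `κ` of third central moments. -/
def skewDiff {d : ℕ} (P Q : MeasureTheory.Measure (Vec d)) (i j k : Fin d) : ℝ :=
  thirdCentralMoment P i j k - thirdCentralMoment Q i j k

/-- The alignment `β · μ = ∑_{i,j} κ_{iij} μ_j`. -/
def betaDotMu {d : ℕ} (P Q : MeasureTheory.Measure (Vec d)) : ℝ :=
  ∑ i, ∑ j, skewDiff P Q i i j * meanDiff P Q j

/-- The bracket `2‖Δ‖_F² + Tr(Δ)² - ‖μ‖⁴ - 4 β · μ`. -/
def secondBracket {d : ℕ} (P Q : MeasureTheory.Measure (Vec d)) : ℝ :=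
  2 * (∑ i, ∑ j, (covDiff P Q i j) ^ 2) + (covDiff P Q).trace ^ 2
    - ‖meanDiff P Q‖ ^ 4 - 4 * betaDotMu P Q

/-- `H̃ = |exp((U + V)/2)|²`. -/
def Htilde {d : ℕ} (U V : Vec d → ℂ) (ω : Vec d) : ℝ :=
  ‖Complex.exp ((U ω + V ω) / 2)‖ ^ 2

open Classical in
/-- The `C⁵` norm on the closed ball of radius `r`,
`sup_{‖ω‖ ≤ r} ∑_{|α| ≤ 5} |∂^α f(ω)|`. A multi-index `α` of order `k` is recorded by the
nondecreasing list `i 0 ≤ … ≤ i (k-1)` in which each coordinate `m` occurs `α m` times, and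
`∂^α f(ω)` is the `k`-th derivative of `f` at `ω` on the corresponding basis vectors. -/
def cFiveNorm {d : ℕ} (r : ℝ) (f : Vec d → ℂ) : ℝ≥0∞ :=
  ⨆ ω ∈ Metric.closedBall (0 : Vec d) r,
    ∑ k ∈ Finset.range 6, ∑ i : Fin k → Fin d with Monotone i,
      ‖iteratedFDeriv ℝ k f ω (fun j => EuclideanSpace.single (i j) (1 : ℝ))‖ₑ

/-- The assumptions at the scale `lam`: the laws `P` of `X` and `Q` of `Y` have finite third
moments and characteristic functions `e^U` and `e^V`; `H̃(ω) = H(lam ω)`; and, with `W = U - V`,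
the functions `e^W` and `e^{-W}` are `C⁵` with norms controlled by `B`, where
`∫ H(lam ω) ‖ω‖⁵ B(‖ω‖) / ‖ω‖^(d+1) dω ≤ K / lam^(4-b)`. -/
structure Assumptions {d : ℕ} (H : Vec d → ℝ) (B : ℝ → ℝ≥0) (b K lam : ℝ)
    (P Q : MeasureTheory.Measure (Vec d)) (U V : Vec d → ℂ) : Prop where
  probP : MeasureTheory.IsProbabilityMeasure P
  probQ : MeasureTheory.IsProbabilityMeasure Q
  momentP : MeasureTheory.MemLp (fun x : Vec d => x) 3 P
  momentQ : MeasureTheory.MemLp (fun x : Vec d => x) 3 Q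
  charP : ∀ ω, MeasureTheory.charFun P ω = Complex.exp (U ω)
  charQ : ∀ ω, MeasureTheory.charFun Q ω = Complex.exp (V ω)
  decay : ∀ ω, Htilde U V ω = H (lam • ω)
  smooth_pos : ContDiff ℝ 5 (fun ω => Complex.exp (U ω - V ω))
  smooth_neg : ContDiff ℝ 5 (fun ω => Complex.exp (-(U ω - V ω)))
  bound : ∀ r : ℝ, 0 ≤ r →
    cFiveNorm r (fun ω => Complex.exp (U ω - V ω))
      + cFiveNorm r (fun ω => Complex.exp (-(U ω - V ω))) ≤ (B r : ℝ≥0∞)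
  growth : (∫⁻ ω : Vec d, ENNReal.ofReal (H (lam • ω) / ‖ω‖ ^ (d + 1) * ‖ω‖ ^ 5 * (B ‖ω‖ : ℝ)))
    ≤ ENNReal.ofReal (K / lam ^ (4 - b))

end EnergyDist

end

/-! ### The weight `1 / ‖ω‖ ^ (d + 1)` and the Fourier representation of the norm -/

namespace EnergyDist

open MeasureTheory Real Set

/-! Integrating `(1 - cos ⟨ω, x⟩) / ‖ω‖ ^ (d + 1)` over `ω` gives a multiple `c_d ‖x‖` of the norm.
Taking expectations turns the energy distance into `1 / (2 c_d)` times the integral of `|φ_P - φ_Q|²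
/ ‖ω‖ ^ (d + 1)` (`energyDistSq_eq_integral_charFun`).

Put `f = e^W = φ_P / φ_Q`. Then `|φ_P - φ_Q|² = |φ_P| |φ_Q| · |f - 1|² / |f|`. The first factor is
`H(λω)`, hence radial; all dependence on the laws beyond it sits in `|f - 1|² / |f|`. Along a ray,
the Taylor coefficients of `log f` are differences of cumulants, which up to order three are means,
covariances and third central moments. With `m`, `D`, `κ` the linear, quadratic and cubic forms of
these differences, `f` starts as `exp(i m - D/2 - iκ/6)` and `|f - 1|² / |f| = m² + (D²/4 - mκ/3 -
m⁴/12) + O(‖ω‖⁵ B(‖ω‖))`, with no cubic term because the Taylor coefficients of `f` are alternately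
real and imaginary. The bounds on `f` and `1/f` also bound the coefficients, so the implied constant
depends only on `d` and `B`; this is `exists_quotient_expansion`.

Against a radial weight, a quadratic form integrates through its trace over `d`, and a quartic form
through its three pair contractions over `d (d + 2)`. The contractions of the quartic form above add
up to a quarter of the bracket in the theorem (`sum_quarticCoeff`). Polar coordinates leave the
one-dimensional integrals of `h`, and `r ↦ λr` produces the powers of `λ`. The constant `c_d` and
the volume of the ball combine to a ratio of Gamma functions, which log-convexity pins to `1 +
O(1/d)`. The remainder is controlled by hypothesis (c). -/

theorem lintegral_rpow_neg_three_halves_mul_exp {t : ℝ} (ht : 0 < t) :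
    ∫⁻ s in Ioi (0 : ℝ), ENNReal.ofReal (s ^ (-(3 / 2) : ℝ) * exp (-(t / s)))
      = ENNReal.ofReal (√π * t ^ (-(1 / 2) : ℝ)) := by
  have h1 : ∫ s in Ioi (0 : ℝ), s ^ (-(3 / 2) : ℝ) * exp (-(t / s)) = √π * t ^ (-(1 / 2) : ℝ) := by
    -- The substitution `s ↦ s⁻¹` turns the integral into the one defining `Γ(1/2) = √π`.
    have h := integral_comp_rpow_Ioi
      (fun y : ℝ => y ^ ((1 / 2 : ℝ) - 1) * exp (-(t * y))) (p := -1) (by norm_num)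
    rw [Real.integral_rpow_mul_exp_neg_mul_Ioi (by norm_num) ht, Real.Gamma_one_half_eq] at h
    have h2 : (1 / t) ^ (1 / 2 : ℝ) * √π = √π * t ^ (-(1 / 2) : ℝ) := by
      rw [one_div, Real.inv_rpow ht.le, ← Real.rpow_neg ht.le, mul_comm]
    rw [← h2, ← h]
    refine setIntegral_congr_fun measurableSet_Ioi fun s hs => ?_
    have hs : 0 < s := hs
    simp only [smul_eq_mul, abs_neg, abs_one, one_mul]
    rw [← Real.rpow_mul hs.le, ← mul_assoc, ← Real.rpow_add hs, Real.rpow_neg_one]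
    norm_num [div_eq_mul_inv]
  have hpos : 0 < √π * t ^ (-(1 / 2) : ℝ) := by positivity
  rw [← h1]
  -- A non-integrable function has Bochner integral `0` by convention, so a nonzero value already
  -- proves integrability.
  refine (ofReal_integral_eq_lintegral_ofReal (Integrable.of_integral_ne_zero ?_) ?_).symm
  · rw [h1]; exact hpos.ne'
  · filter_upwards [ae_restrict_mem measurableSet_Ioi] with s hs
    have hs : 0 < s := hs
    simp only [Pi.zero_apply]
    positivity

theorem lintegral_exp_neg_div {s c : ℝ} (hs : 0 < s) (hc : 0 ≤ c) :
    ∫⁻ t in Ioc 0 c, ENNReal.ofReal (s ^ (-(3 / 2) : ℝ) * exp (-(t / s)))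
      = ENNReal.ofReal (s ^ (-(1 / 2) : ℝ) * (1 - exp (-(c / s)))) := by
  have hcont : Continuous fun t : ℝ => s ^ (-(3 / 2) : ℝ) * exp (-(t / s)) := by fun_prop
  have h1 : ∫ t in (0 : ℝ)..c, s ^ (-(3 / 2) : ℝ) * exp (-(t / s))
      = s ^ (-(1 / 2) : ℝ) * (1 - exp (-(c / s))) := by
    have hd : ∀ t ∈ uIcc 0 c, HasDerivAt (fun t => -(s ^ (-(1 / 2) : ℝ)) * exp (-(t / s)))
        (s ^ (-(3 / 2) : ℝ) * exp (-(t / s))) t := by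
      intro t _
      have h := ((((hasDerivAt_id t).div_const s).neg).exp).const_mul (-(s ^ (-(1 / 2) : ℝ)))
      refine HasDerivAt.congr_deriv h ?_
      have : s ^ (-(3 / 2) : ℝ) = s ^ (-(1 / 2) : ℝ) * s⁻¹ := by
        rw [← Real.rpow_neg_one s, ← Real.rpow_add hs]; norm_num
      rw [this]
      simp only [id, Pi.neg_apply]
      ring
    rw [intervalIntegral.integral_eq_sub_of_hasDerivAt hd (hcont.intervalIntegrable _ _)]
    simp only [zero_div, neg_zero, exp_zero]
    ring
  rw [← h1, intervalIntegral.integral_of_le hc]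
  refine (ofReal_integral_eq_lintegral_ofReal ?_ ?_).symm
  · exact (hcont.intervalIntegrable 0 c).1
  · exact Filter.Eventually.of_forall fun t => by simp only [Pi.zero_apply]; positivity

/-- The factor `1 - exp (-(c / s))` is itself an integral over `t ∈ (0, c]`. Exchanging the two
integrals leaves a Gamma integral in `s` and then a power of `t`. -/
theorem lintegral_rpow_neg_half_mul_one_sub_exp {c : ℝ} (hc : 0 ≤ c) :
    ∫⁻ s in Ioi (0 : ℝ), ENNReal.ofReal (s ^ (-(1 / 2) : ℝ) * (1 - exp (-(c / s))))
      = ENNReal.ofReal (2 * √π * √c) := by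
  have h1 : ∫⁻ s in Ioi (0 : ℝ), ENNReal.ofReal (s ^ (-(1 / 2) : ℝ) * (1 - exp (-(c / s))))
      = ∫⁻ s in Ioi (0 : ℝ), ∫⁻ t in Ioc 0 c,
          ENNReal.ofReal (s ^ (-(3 / 2) : ℝ) * exp (-(t / s))) :=
    setLIntegral_congr_fun measurableSet_Ioi fun s hs => (lintegral_exp_neg_div hs hc).symm
  rw [h1, lintegral_lintegral_swap (by fun_prop)]
  have h2 : ∫⁻ t in Ioc 0 c, ∫⁻ s in Ioi (0 : ℝ),
        ENNReal.ofReal (s ^ (-(3 / 2) : ℝ) * exp (-(t / s)))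
      = ∫⁻ t in Ioc 0 c, ENNReal.ofReal (√π * t ^ (-(1 / 2) : ℝ)) :=
    setLIntegral_congr_fun measurableSet_Ioc fun t ht =>
      lintegral_rpow_neg_three_halves_mul_exp ht.1
  have hint : IntervalIntegrable (fun t : ℝ => √π * t ^ (-(1 / 2) : ℝ)) volume 0 c :=
    (intervalIntegral.intervalIntegrable_rpow' (by norm_num)).const_mul _
  rw [h2, ← ofReal_integral_eq_lintegral_ofReal hint.1, ← intervalIntegral.integral_of_le hc,
    intervalIntegral.integral_const_mul, integral_rpow (Or.inl (by norm_num))]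
  · congr 1
    norm_num
    rw [← Real.sqrt_eq_rpow]; ring
  · filter_upwards [ae_restrict_mem measurableSet_Ioc] with t ht
    have := ht.1
    simp only [Pi.zero_apply]
    positivity

variable {d : ℕ}

theorem integral_one_sub_cos_mul_gaussian (x : Vec d) {s : ℝ} (hs : 0 < s) :
    Integrable (fun ω : Vec d => exp (-(s * ‖ω‖ ^ 2)) * (1 - cos (inner ℝ ω x))) ∧
    ∫ ω : Vec d, exp (-(s * ‖ω‖ ^ 2)) * (1 - cos (inner ℝ ω x))
      = (π / s) ^ ((d : ℝ) / 2) * (1 - exp (-(‖x‖ ^ 2 / 4 / s))) := by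
  have hs' : 0 < (s : ℂ).re := by simpa using hs
  have key : ∀ y : Vec d,
      Integrable (fun ω : Vec d => exp (-(s * ‖ω‖ ^ 2)) * cos (inner ℝ ω y)) ∧
      ∫ ω : Vec d, exp (-(s * ‖ω‖ ^ 2)) * cos (inner ℝ ω y)
        = (π / s) ^ ((d : ℝ) / 2) * exp (-(‖y‖ ^ 2 / 4 / s)) := by
    intro y
    have h1 := GaussianFourier.integral_cexp_neg_mul_sq_norm_add hs' Complex.I y
    have h2 := GaussianFourier.integrable_cexp_neg_mul_sq_norm_add hs' Complex.I y
    have hre : ∀ ω : Vec d, (Complex.exp (-(s : ℂ) * (‖ω‖ : ℂ) ^ 2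
        + Complex.I * ((inner ℝ y ω : ℝ) : ℂ))).re
        = exp (-(s * ‖ω‖ ^ 2)) * cos (inner ℝ ω y) := by
      intro ω
      rw [Complex.exp_re, real_inner_comm]
      congr 2 <;> simp [← Complex.ofReal_pow]
    refine ⟨?_, ?_⟩
    · have := h2.re
      simpa only [RCLike.re_to_complex, hre] using this
    · have h3 := integral_re h2
      simp only [RCLike.re_to_complex, hre] at h3
      rw [h3, h1]
      have : ((π : ℂ) / (s : ℂ)) ^ ((Module.finrank ℝ (Vec d) : ℂ) / 2)
          * Complex.exp (Complex.I ^ 2 * (‖y‖ : ℂ) ^ 2 / (4 * (s : ℂ)))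
          = (((π / s) ^ ((d : ℝ) / 2) * exp (-(‖y‖ ^ 2 / 4 / s)) : ℝ) : ℂ) := by
        push_cast
        rw [Complex.ofReal_cpow (by positivity)]
        simp only [finrank_euclideanSpace, Fintype.card_fin, Complex.I_sq]
        push_cast
        congr 2
        field_simp
      rw [this, Complex.ofReal_re]
  have hx := key x
  have h0 := key 0
  simp only [inner_zero_right, cos_zero, norm_zero] at h0
  simp only [mul_sub]
  refine ⟨h0.1.sub hx.1, ?_⟩
  rw [integral_sub h0.1 hx.1, h0.2, hx.2]
  simp

/-- The constant `c_d` in `∫ (1 - cos ⟨ω, x⟩) / ‖ω‖^(d+1) dω = c_d ‖x‖`. -/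
noncomputable def szekelyConst (d : ℕ) : ℝ := π ^ (((d : ℝ) + 1) / 2) / Gamma (((d : ℝ) + 1) / 2)

theorem szekelyConst_pos (d : ℕ) : 0 < szekelyConst d := by
  unfold szekelyConst
  have := Gamma_pos_of_pos (show (0 : ℝ) < ((d : ℝ) + 1) / 2 by positivity)
  positivity

/-- Subordination: the Gamma integral writes a negative power of `‖ω‖` as a mixture of Gaussians,
whose Fourier transforms are explicit. The condition `h0` is needed because at `ω = 0` the left side
is `0` by convention, while the right side diverges unless `a = 0`. -/
theorem ofReal_div_norm_pow_eq_lintegral (ω : Vec d) {a : ℝ} (ha : 0 ≤ a) (h0 : ω = 0 → a = 0) :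
    ENNReal.ofReal (a / ‖ω‖ ^ (d + 1))
      = ENNReal.ofReal (1 / Gamma (((d : ℝ) + 1) / 2)) * ∫⁻ s in Ioi (0 : ℝ),
          ENNReal.ofReal (s ^ (((d : ℝ) + 1) / 2 - 1) * (exp (-(s * ‖ω‖ ^ 2)) * a)) := by
  by_cases hω : ω = 0
  · simp [h0 hω]
  have hn : 0 < ‖ω‖ := norm_pos_iff.2 hω
  have hd : (0 : ℝ) < ((d : ℝ) + 1) / 2 := by positivity
  have hG := Gamma_pos_of_pos hd
  have h1 := Real.integral_rpow_mul_exp_neg_mul_Ioi hd (show 0 < ‖ω‖ ^ 2 by positivity)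
  have hp : (1 / ‖ω‖ ^ 2) ^ (((d : ℝ) + 1) / 2) = 1 / ‖ω‖ ^ (d + 1) := by
    rw [one_div, Real.inv_rpow (by positivity), ← Real.rpow_natCast, ← Real.rpow_mul hn.le, one_div]
    congr 1
    rw [← Real.rpow_natCast]; push_cast; congr 1; ring
  rw [hp] at h1
  have hint : IntegrableOn (fun s : ℝ => s ^ (((d : ℝ) + 1) / 2 - 1) * exp (-(‖ω‖ ^ 2 * s)))
      (Ioi 0) := by
    refine Integrable.of_integral_ne_zero ?_
    rw [h1]; positivity
  have h2 : ∫ s in Ioi (0 : ℝ), s ^ (((d : ℝ) + 1) / 2 - 1) * (exp (-(s * ‖ω‖ ^ 2)) * a)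
      = 1 / ‖ω‖ ^ (d + 1) * Gamma (((d : ℝ) + 1) / 2) * a := by
    rw [← h1, ← integral_mul_const]
    simp only [mul_assoc, mul_comm (‖ω‖ ^ 2)]
  rw [← ofReal_integral_eq_lintegral_ofReal, h2, ← ENNReal.ofReal_mul (by positivity)]
  · congr 1; field_simp
  · have := hint.mul_const a
    simpa only [IntegrableOn, mul_assoc, mul_comm (‖ω‖ ^ 2)] using this
  · filter_upwards [ae_restrict_mem measurableSet_Ioi] with s hs
    have hs : 0 < s := hs
    simp only [Pi.zero_apply]
    positivity

/-- Tonelli for the Gaussian mixture: each Gaussian contributes `π ^ (d/2) s ^ (-1/2) (1 - exp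
(-‖x‖² / (4 s)))` after the powers of `s` cancel, and the `s`-integral yields `‖x‖`. -/
theorem lintegral_one_sub_cos_div_norm_pow (x : Vec d) :
    ∫⁻ ω : Vec d, ENNReal.ofReal ((1 - cos (inner ℝ ω x)) / ‖ω‖ ^ (d + 1))
      = ENNReal.ofReal (szekelyConst d * ‖x‖) := by
  have hd : (0 : ℝ) < ((d : ℝ) + 1) / 2 := by positivity
  have hG := Gamma_pos_of_pos hd
  have h1 : ∀ ω : Vec d, ENNReal.ofReal ((1 - cos (inner ℝ ω x)) / ‖ω‖ ^ (d + 1)) = _ :=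
    fun ω => ofReal_div_norm_pow_eq_lintegral ω (sub_nonneg.2 (cos_le_one _))
      (by rintro rfl; simp)
  simp_rw [h1]
  rw [lintegral_const_mul' _ _ ENNReal.ofReal_ne_top, lintegral_lintegral_swap (by fun_prop)]
  have h2 : ∀ s ∈ Ioi (0 : ℝ), ∫⁻ ω : Vec d, ENNReal.ofReal
      (s ^ (((d : ℝ) + 1) / 2 - 1) * (exp (-(s * ‖ω‖ ^ 2)) * (1 - cos (inner ℝ ω x))))
      = ENNReal.ofReal (π ^ ((d : ℝ) / 2))
        * ENNReal.ofReal (s ^ (-(1 / 2) : ℝ) * (1 - exp (-(‖x‖ ^ 2 / 4 / s)))) := by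
    intro s hs
    have hs : 0 < s := hs
    obtain ⟨hi, hv⟩ := integral_one_sub_cos_mul_gaussian x hs
    simp_rw [ENNReal.ofReal_mul (show 0 ≤ s ^ (((d : ℝ) + 1) / 2 - 1) by positivity)]
    rw [lintegral_const_mul' _ _ ENNReal.ofReal_ne_top, ← ofReal_integral_eq_lintegral_ofReal hi,
      hv, ← ENNReal.ofReal_mul (by positivity), ← ENNReal.ofReal_mul (by positivity)]
    · congr 1
      rw [Real.div_rpow pi_pos.le hs.le, ← mul_assoc, ← mul_assoc]
      congr 1
      rw [div_eq_mul_inv (π ^ _), ← Real.rpow_neg hs.le, mul_left_comm, ← Real.rpow_add hs]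
      congr 2; ring
    · exact Filter.Eventually.of_forall fun ω =>
        mul_nonneg (exp_pos _).le (sub_nonneg.2 (cos_le_one _))
  rw [setLIntegral_congr_fun measurableSet_Ioi h2, lintegral_const_mul' _ _ ENNReal.ofReal_ne_top,
    lintegral_rpow_neg_half_mul_one_sub_exp (by positivity),
    ← ENNReal.ofReal_mul (by positivity), ← ENNReal.ofReal_mul (by positivity)]
  congr 1
  have h4 : √(‖x‖ ^ 2 / 4) = ‖x‖ / 2 := by
    rw [show ‖x‖ ^ 2 / 4 = (‖x‖ / 2) ^ 2 by ring, Real.sqrt_sq (by positivity)]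
  have h5 : π ^ (((d : ℝ) + 1) / 2) = π ^ ((d : ℝ) / 2) * √π := by
    rw [Real.sqrt_eq_rpow, ← Real.rpow_add pi_pos]; congr 1; ring
  rw [h4, szekelyConst, h5]
  ring

end EnergyDist

/-! ### The energy distance in terms of characteristic functions -/

namespace EnergyDist

open MeasureTheory Real Set

variable {d : ℕ}

theorem re_charFun_eq_integral_cos (ρ : Measure (Vec d)) [IsProbabilityMeasure ρ] (ω : Vec d) :
    (charFun ρ ω).re = ∫ x, cos (inner ℝ ω x) ∂ρ := by
  have hi : Integrable (fun x : Vec d => Complex.exp ((inner ℝ x ω : ℝ) * Complex.I)) ρ := by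
    refine (integrable_const (1 : ℝ)).mono' (by fun_prop) (Filter.Eventually.of_forall fun x => ?_)
    rw [Complex.norm_exp_ofReal_mul_I]
  rw [charFun_apply]
  have h := integral_re hi
  simp only [RCLike.re_to_complex, Complex.exp_ofReal_mul_I_re] at h
  rw [← h]
  simp_rw [real_inner_comm]

/-- The mean norm of a law as a weighted integral of its characteristic function. -/
theorem integral_one_sub_re_charFun (ρ : Measure (Vec d)) [IsProbabilityMeasure ρ]
    (hρ : Integrable (fun x : Vec d => x) ρ) :
    Integrable (fun ω : Vec d => (1 - (charFun ρ ω).re) / ‖ω‖ ^ (d + 1)) ∧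
    ∫ ω : Vec d, (1 - (charFun ρ ω).re) / ‖ω‖ ^ (d + 1) = szekelyConst d * ∫ x, ‖x‖ ∂ρ := by
  have hc := szekelyConst_pos d
  set F : Vec d × Vec d → ℝ := fun z => (1 - cos (inner ℝ z.1 z.2)) / ‖z.1‖ ^ (d + 1) with hF
  have hFm : Measurable F := by
    refine Measurable.div ?_ (by fun_prop)
    exact (continuous_const.sub (Real.continuous_cos.comp
      (continuous_fst.inner continuous_snd))).measurable
  have hF0 : ∀ z, 0 ≤ F z := fun z => div_nonneg (sub_nonneg.2 (cos_le_one _)) (by positivity)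
  have hl : ∫⁻ z, ENNReal.ofReal (F z) ∂((volume : Measure (Vec d)).prod ρ)
      = ENNReal.ofReal (szekelyConst d * ∫ x, ‖x‖ ∂ρ) := by
    rw [lintegral_prod_symm _ hFm.ennreal_ofReal.aemeasurable]
    simp only [hF, lintegral_one_sub_cos_div_norm_pow]
    rw [← integral_const_mul, ofReal_integral_eq_lintegral_ofReal (hρ.norm.const_mul _)]
    exact Filter.Eventually.of_forall fun x => by simp only [Pi.zero_apply]; positivity
  have hint : Integrable F ((volume : Measure (Vec d)).prod ρ) := by
    refine ⟨hFm.aestronglyMeasurable, ?_⟩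
    rw [hasFiniteIntegral_iff_ofReal (Filter.Eventually.of_forall hF0), hl]
    exact ENNReal.ofReal_lt_top
  have hinner : ∀ ω : Vec d, ∫ x, F (ω, x) ∂ρ = (1 - (charFun ρ ω).re) / ‖ω‖ ^ (d + 1) := by
    intro ω
    have hcos : Integrable (fun x : Vec d => cos (inner ℝ ω x)) ρ := by
      refine (integrable_const (1 : ℝ)).mono' (by fun_prop)
        (Filter.Eventually.of_forall fun x => ?_)
      exact abs_cos_le_one _
    simp only [hF]
    rw [integral_div, integral_sub (integrable_const _) hcos, re_charFun_eq_integral_cos]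
    simp
  refine ⟨by simpa only [hinner] using hint.integral_prod_left, ?_⟩
  have h1 := integral_prod F hint
  simp only [hinner] at h1
  rw [← h1, integral_eq_lintegral_of_nonneg_ae (Filter.Eventually.of_forall hF0)
    hFm.aestronglyMeasurable, hl, ENNReal.toReal_ofReal]
  exact mul_nonneg hc.le (integral_nonneg fun _ => norm_nonneg _)

theorem charFun_map_sub_prod (P Q : Measure (Vec d)) [IsProbabilityMeasure P]
    [IsProbabilityMeasure Q] (ω : Vec d) :
    charFun ((P.prod Q).map fun z => z.1 - z.2) ω
      = charFun P ω * (starRingEnd ℂ) (charFun Q ω) := by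
  rw [← charFun_neg, charFun_apply, charFun_apply, charFun_apply,
    integral_map (by fun_prop) (by fun_prop), ← integral_prod_mul]
  refine integral_congr_ae (Filter.Eventually.of_forall fun z => ?_)
  simp only [← Complex.exp_add, inner_sub_left, inner_neg_right]
  push_cast
  ring_nf

theorem integral_prod_one_sub_re (P Q : Measure (Vec d)) [IsProbabilityMeasure P]
    [IsProbabilityMeasure Q] (hP : Integrable (fun x : Vec d => x) P)
    (hQ : Integrable (fun x : Vec d => x) Q) :
    Integrable (fun ω : Vec d =>
      (1 - (charFun P ω * (starRingEnd ℂ) (charFun Q ω)).re) / ‖ω‖ ^ (d + 1)) ∧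
    ∫ ω : Vec d, (1 - (charFun P ω * (starRingEnd ℂ) (charFun Q ω)).re) / ‖ω‖ ^ (d + 1)
      = szekelyConst d * ∫ z, ‖z.1 - z.2‖ ∂(P.prod Q) := by
  have : IsProbabilityMeasure ((P.prod Q).map fun z : Vec d × Vec d => z.1 - z.2) :=
    Measure.isProbabilityMeasure_map (by fun_prop)
  have hi : Integrable (fun x : Vec d => x) ((P.prod Q).map fun z => z.1 - z.2) := by
    rw [integrable_map_measure (by fun_prop) (by fun_prop)]
    exact (hP.comp_fst Q).sub (hQ.comp_snd P)
  have h := integral_one_sub_re_charFun _ hi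
  simp only [charFun_map_sub_prod] at h
  rwa [integral_map (by fun_prop) (by fun_prop)] at h

/-- The squared energy distance as a weighted `L²` distance of characteristic functions. -/
theorem energyDistSq_eq_integral_charFun (P Q : Measure (Vec d)) [IsProbabilityMeasure P]
    [IsProbabilityMeasure Q] (hP : Integrable (fun x : Vec d => x) P)
    (hQ : Integrable (fun x : Vec d => x) Q) :
    Integrable (fun ω : Vec d => ‖charFun P ω - charFun Q ω‖ ^ 2 / ‖ω‖ ^ (d + 1)) ∧
    energyDistSq P Q = 1 / (2 * szekelyConst d)
      * ∫ ω : Vec d, ‖charFun P ω - charFun Q ω‖ ^ 2 / ‖ω‖ ^ (d + 1) := by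
  have hc := szekelyConst_pos d
  obtain ⟨i1, v1⟩ := integral_prod_one_sub_re P Q hP hQ
  obtain ⟨i2, v2⟩ := integral_prod_one_sub_re P P hP hP
  obtain ⟨i3, v3⟩ := integral_prod_one_sub_re Q Q hQ hQ
  -- Pointwise, `|φ_P - φ_Q|² = 2 (1 - Re φ_P φ̄_Q) - (1 - |φ_P|²) - (1 - |φ_Q|²)`, and the three
  -- terms belong to the laws of `X - Y`, `X - X'` and `Y - Y'`.
  have heq : (fun ω : Vec d => ‖charFun P ω - charFun Q ω‖ ^ 2 / ‖ω‖ ^ (d + 1))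
      = fun ω => 2 * ((1 - (charFun P ω * (starRingEnd ℂ) (charFun Q ω)).re) / ‖ω‖ ^ (d + 1))
        - (1 - (charFun P ω * (starRingEnd ℂ) (charFun P ω)).re) / ‖ω‖ ^ (d + 1)
        - (1 - (charFun Q ω * (starRingEnd ℂ) (charFun Q ω)).re) / ‖ω‖ ^ (d + 1) := by
    funext ω
    rw [← Complex.normSq_eq_norm_sq]
    simp only [Complex.normSq_apply, Complex.sub_re, Complex.sub_im, Complex.mul_re,
      Complex.conj_re, Complex.conj_im]
    ring
  rw [heq]
  refine ⟨((i1.const_mul 2).sub i2).sub i3, ?_⟩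
  rw [integral_sub, integral_sub (i1.const_mul 2) i2, integral_const_mul, v1, v2, v3, energyDistSq]
  · field_simp
  · exact (i1.const_mul 2).sub i2
  · exact i3

end EnergyDist

/-! ### Moments of radial weights -/

namespace EnergyDist

open MeasureTheory Real Set

variable {d : ℕ}

/-- The reflection in the hyperplane orthogonal to `u - v` carries `u` to `v` and preserves both the
norm and Lebesgue measure. -/
theorem integral_radial_mul_inner_eq {u v : Vec d} (huv : ‖u‖ = ‖v‖) (w k : ℝ → ℝ) :
    ∫ ω : Vec d, w ‖ω‖ * k (inner ℝ u ω) = ∫ ω : Vec d, w ‖ω‖ * k (inner ℝ v ω) := by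
  let R := (ℝ ∙ (u - v))ᗮ.reflection
  have hR : R u = v := Submodule.reflection_sub huv
  have h := R.measurePreserving.integral_comp R.toHomeomorph.measurableEmbedding
    (fun ω : Vec d => w ‖ω‖ * k (inner ℝ v ω))
  rw [← h]
  refine integral_congr_ae (Filter.Eventually.of_forall fun ω => ?_)
  simp only [← hR, LinearIsometryEquiv.norm_map, LinearIsometryEquiv.inner_map_map]

theorem integral_radial_mul_inner_pow (w : ℝ → ℝ) (n : ℕ) {e : Vec d} (he : ‖e‖ = 1) (v : Vec d) :
    ∫ ω : Vec d, w ‖ω‖ * inner ℝ v ω ^ n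
      = ‖v‖ ^ n * ∫ ω : Vec d, w ‖ω‖ * inner ℝ e ω ^ n := by
  have h := integral_radial_mul_inner_eq (u := v) (v := ‖v‖ • e) (by simp [norm_smul, he]) w
    (fun t => t ^ n)
  rw [h, ← integral_const_mul]
  refine integral_congr_ae (Filter.Eventually.of_forall fun ω => ?_)
  simp only [real_inner_smul_left]
  ring

theorem integrable_radial_mul {w : ℝ → ℝ} (hw : AEStronglyMeasurable (fun ω : Vec d => w ‖ω‖))
    {n : ℕ} (hi : Integrable (fun ω : Vec d => w ‖ω‖ * ‖ω‖ ^ n)) {q : Vec d → ℝ} (hq : Continuous q)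
    {c : ℝ} (hc : ∀ ω, |q ω| ≤ c * ‖ω‖ ^ n) : Integrable (fun ω : Vec d => w ‖ω‖ * q ω) := by
  refine (hi.norm.const_mul c).mono' (hw.mul hq.aestronglyMeasurable)
    (Filter.Eventually.of_forall fun ω => ?_)
  have := mul_le_mul_of_nonneg_left (hc ω) (abs_nonneg (w ‖ω‖))
  rw [Real.norm_eq_abs, Real.norm_eq_abs, abs_mul, abs_mul, abs_of_nonneg (by positivity : 0 ≤ ‖ω‖ ^ n)]
  linarith

theorem integrable_radial_mul_inner_pow {w : ℝ → ℝ}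
    (hw : AEStronglyMeasurable (fun ω : Vec d => w ‖ω‖))
    {n : ℕ} (hi : Integrable (fun ω : Vec d => w ‖ω‖ * ‖ω‖ ^ n)) (v : Vec d) :
    Integrable (fun ω : Vec d => w ‖ω‖ * inner ℝ v ω ^ n) := by
  refine integrable_radial_mul hw hi (by fun_prop) (c := ‖v‖ ^ n) fun ω => ?_
  rw [abs_pow, ← mul_pow]
  exact pow_le_pow_left₀ (abs_nonneg _) (abs_real_inner_le_norm v ω) n

theorem integral_radial_mul_inner_mul_inner_aux {w : ℝ → ℝ}
    (hw : AEStronglyMeasurable (fun ω : Vec d => w ‖ω‖))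
    (hi : Integrable (fun ω : Vec d => w ‖ω‖ * ‖ω‖ ^ 2)) {e : Vec d} (he : ‖e‖ = 1) (a b : Vec d) :
    ∫ ω : Vec d, w ‖ω‖ * (inner ℝ a ω * inner ℝ b ω)
      = inner ℝ a b * ∫ ω : Vec d, w ‖ω‖ * inner ℝ e ω ^ 2 := by
  have hI := fun v => integrable_radial_mul_inner_pow hw hi v
  have h1 : ∀ ω : Vec d, w ‖ω‖ * (inner ℝ a ω * inner ℝ b ω)
      = 1 / 4 * (w ‖ω‖ * inner ℝ (a + b) ω ^ 2 - w ‖ω‖ * inner ℝ (a - b) ω ^ 2) := by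
    intro ω
    rw [inner_add_left, inner_sub_left]
    ring
  simp_rw [h1]
  rw [integral_const_mul, integral_sub (hI _) (hI _), integral_radial_mul_inner_pow w 2 he (a + b),
    integral_radial_mul_inner_pow w 2 he (a - b), norm_add_sq_real, norm_sub_sq_real]
  ring

/-- Polarization of the fourth power: the signed sum over the eight choices of signs of `x₂, x₃, x₄`
is `8 · 4! = 192` times the product. Each fourth power integrates to a multiple of `⟨v, v⟩²`, whose
polarization is the sum over the three pairings. -/
theorem integral_radial_mul_inner_four_aux {w : ℝ → ℝ}
    (hw : AEStronglyMeasurable (fun ω : Vec d => w ‖ω‖))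
    (hi : Integrable (fun ω : Vec d => w ‖ω‖ * ‖ω‖ ^ 4)) {e : Vec d} (he : ‖e‖ = 1)
    (x₁ x₂ x₃ x₄ : Vec d) :
    ∫ ω : Vec d, w ‖ω‖ * (inner ℝ x₁ ω * inner ℝ x₂ ω * inner ℝ x₃ ω * inner ℝ x₄ ω)
      = (inner ℝ x₁ x₂ * inner ℝ x₃ x₄ + inner ℝ x₁ x₃ * inner ℝ x₂ x₄
          + inner ℝ x₁ x₄ * inner ℝ x₂ x₃) / 3
        * ∫ ω : Vec d, w ‖ω‖ * inner ℝ e ω ^ 4 := by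
  have hI := fun v => integrable_radial_mul_inner_pow hw hi v
  have hsq : ∀ v : Vec d, ‖v‖ ^ 4 = (inner ℝ v v : ℝ) ^ 2 := fun v => by
    rw [real_inner_self_eq_norm_sq]; ring
  have h1 : ∀ ω : Vec d,
      w ‖ω‖ * (inner ℝ x₁ ω * inner ℝ x₂ ω * inner ℝ x₃ ω * inner ℝ x₄ ω)
      = 1 / 192 * ((((w ‖ω‖ * inner ℝ (x₁ + x₂ + x₃ + x₄) ω ^ 4
        - w ‖ω‖ * inner ℝ (x₁ + x₂ + x₃ - x₄) ω ^ 4)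
        - (w ‖ω‖ * inner ℝ (x₁ + x₂ - x₃ + x₄) ω ^ 4
          - w ‖ω‖ * inner ℝ (x₁ + x₂ - x₃ - x₄) ω ^ 4))
        - ((w ‖ω‖ * inner ℝ (x₁ - x₂ + x₃ + x₄) ω ^ 4
          - w ‖ω‖ * inner ℝ (x₁ - x₂ + x₃ - x₄) ω ^ 4)
          - (w ‖ω‖ * inner ℝ (x₁ - x₂ - x₃ + x₄) ω ^ 4
            - w ‖ω‖ * inner ℝ (x₁ - x₂ - x₃ - x₄) ω ^ 4)))) := by
    intro ω
    simp only [inner_add_left, inner_sub_left]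
    ring
  have i2 := fun u v => (hI u).sub (hI v)
  have i4 := fun u v u' v' => (i2 u v).sub (i2 u' v')
  simp_rw [h1]
  rw [integral_const_mul, integral_sub (by exact i4 _ _ _ _) (by exact i4 _ _ _ _),
    integral_sub (by exact i2 _ _) (by exact i2 _ _),
    integral_sub (hI _) (hI _), integral_sub (hI _) (hI _),
    integral_sub (by exact i2 _ _) (by exact i2 _ _),
    integral_sub (hI _) (hI _), integral_sub (hI _) (hI _)]
  have hM := integral_radial_mul_inner_pow w 4 he
  rw [hM (x₁ + x₂ + x₃ + x₄), hM (x₁ + x₂ + x₃ - x₄), hM (x₁ + x₂ - x₃ + x₄),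
    hM (x₁ + x₂ - x₃ - x₄), hM (x₁ - x₂ + x₃ + x₄), hM (x₁ - x₂ + x₃ - x₄),
    hM (x₁ - x₂ - x₃ + x₄), hM (x₁ - x₂ - x₃ - x₄)]
  simp only [hsq, inner_add_left, inner_sub_left, inner_add_right, inner_sub_right]
  rw [real_inner_comm x₁ x₂, real_inner_comm x₁ x₃, real_inner_comm x₁ x₄, real_inner_comm x₂ x₃,
    real_inner_comm x₂ x₄, real_inner_comm x₃ x₄]
  ring

theorem inner_single_one (i : Fin d) (ω : Vec d) :
    inner ℝ (EuclideanSpace.single i (1 : ℝ)) ω = ω i := by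
  simp [EuclideanSpace.inner_single_left]

theorem integral_radial_mul_inner_mul_inner [NeZero d] {w : ℝ → ℝ}
    (hw : AEStronglyMeasurable (fun ω : Vec d => w ‖ω‖))
    (hi : Integrable (fun ω : Vec d => w ‖ω‖ * ‖ω‖ ^ 2)) (a b : Vec d) :
    ∫ ω : Vec d, w ‖ω‖ * (inner ℝ a ω * inner ℝ b ω)
      = inner ℝ a b / d * ∫ ω : Vec d, w ‖ω‖ * ‖ω‖ ^ 2 := by
  have hd : (d : ℝ) ≠ 0 := Nat.cast_ne_zero.2 (NeZero.ne d)
  let e : Vec d := EuclideanSpace.single 0 1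
  have he : ‖e‖ = 1 := by simp [e]
  have hm : ∫ ω : Vec d, w ‖ω‖ * ‖ω‖ ^ 2 = d * ∫ ω : Vec d, w ‖ω‖ * inner ℝ e ω ^ 2 := by
    have h1 : ∀ ω : Vec d, w ‖ω‖ * ‖ω‖ ^ 2 = ∑ i : Fin d, w ‖ω‖ *
        inner ℝ (EuclideanSpace.single i (1 : ℝ)) ω ^ 2 := by
      intro ω
      rw [← Finset.mul_sum, EuclideanSpace.real_norm_sq_eq]
      simp only [inner_single_one]
    simp_rw [h1]
    rw [integral_finsetSum _ fun i _ => integrable_radial_mul_inner_pow hw hi _]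
    have h2 : ∀ i : Fin d, ∫ ω : Vec d, w ‖ω‖ * inner ℝ (EuclideanSpace.single i (1 : ℝ)) ω ^ 2
        = ∫ ω : Vec d, w ‖ω‖ * inner ℝ e ω ^ 2 := fun i => by
      rw [integral_radial_mul_inner_pow w 2 he]; simp
    simp [h2]
  rw [integral_radial_mul_inner_mul_inner_aux hw hi he, hm]
  field_simp

/-- The constant comes from summing the previous formula over `‖ω‖⁴ = ∑ ω_i² ω_j²`: the pairings `1
+ 2 δ_ij` add up to `d² + 2d`. -/
theorem integral_radial_mul_inner_four [NeZero d] {w : ℝ → ℝ}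
    (hw : AEStronglyMeasurable (fun ω : Vec d => w ‖ω‖))
    (hi : Integrable (fun ω : Vec d => w ‖ω‖ * ‖ω‖ ^ 4)) (x₁ x₂ x₃ x₄ : Vec d) :
    ∫ ω : Vec d, w ‖ω‖ * (inner ℝ x₁ ω * inner ℝ x₂ ω * inner ℝ x₃ ω * inner ℝ x₄ ω)
      = (inner ℝ x₁ x₂ * inner ℝ x₃ x₄ + inner ℝ x₁ x₃ * inner ℝ x₂ x₄
          + inner ℝ x₁ x₄ * inner ℝ x₂ x₃) / (d * (d + 2))
        * ∫ ω : Vec d, w ‖ω‖ * ‖ω‖ ^ 4 := by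
  have hd : (d : ℝ) ≠ 0 := Nat.cast_ne_zero.2 (NeZero.ne d)
  have hd2 : (d : ℝ) + 2 ≠ 0 := by positivity
  let e : Vec d := EuclideanSpace.single 0 1
  have he : ‖e‖ = 1 := by simp [e]
  let s : Fin d → Vec d := fun i => EuclideanSpace.single i 1
  have hs : ∀ i j, inner ℝ (s i) (s j) = if i = j then (1 : ℝ) else 0 := fun i j => by
    simp only [s]
    rw [inner_single_one, PiLp.single_apply]
  have hm : ∫ ω : Vec d, w ‖ω‖ * ‖ω‖ ^ 4
      = d * (d + 2) / 3 * ∫ ω : Vec d, w ‖ω‖ * inner ℝ e ω ^ 4 := by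
    have h1 : ∀ ω : Vec d, w ‖ω‖ * ‖ω‖ ^ 4 = ∑ i : Fin d, ∑ j : Fin d, w ‖ω‖ *
        (inner ℝ (s i) ω * inner ℝ (s i) ω * inner ℝ (s j) ω * inner ℝ (s j) ω) := by
      intro ω
      have : ‖ω‖ ^ 4 = (∑ i, ω i ^ 2) * (∑ j, ω j ^ 2) := by
        rw [← EuclideanSpace.real_norm_sq_eq]; ring
      rw [this, Finset.sum_mul_sum, Finset.mul_sum]
      refine Finset.sum_congr rfl fun i _ => ?_
      rw [Finset.mul_sum]
      refine Finset.sum_congr rfl fun j _ => ?_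
      simp only [s, inner_single_one]
      ring
    have hI : ∀ i j : Fin d, Integrable fun ω : Vec d => w ‖ω‖ *
        (inner ℝ (s i) ω * inner ℝ (s i) ω * inner ℝ (s j) ω * inner ℝ (s j) ω) := by
      intro i j
      refine integrable_radial_mul hw hi (by fun_prop) (c := 1) fun ω => ?_
      have hb : ∀ i, |inner ℝ (s i) ω| ≤ ‖ω‖ := fun i => by
        simpa [s] using abs_real_inner_le_norm (s i) ω
      rw [abs_mul, abs_mul, abs_mul]
      calc _ ≤ ‖ω‖ * ‖ω‖ * ‖ω‖ * ‖ω‖ := by gcongr <;> exact hb _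
        _ = _ := by ring
    simp_rw [h1]
    rw [integral_finsetSum _ fun i _ => integrable_finsetSum _ fun j _ => hI i j]
    simp_rw [integral_finsetSum Finset.univ fun j _ => hI _ j,
      integral_radial_mul_inner_four_aux hw hi he, hs, ← Finset.sum_mul, ← Finset.sum_div]
    congr 2
    simp [Finset.sum_add_distrib]
    ring
  rw [integral_radial_mul_inner_four_aux hw hi he, hm]
  field_simp

theorem integrable_radial_mul_coords {w : ℝ → ℝ}
    (hw : AEStronglyMeasurable (fun ω : Vec d => w ‖ω‖))
    (hi : Integrable (fun ω : Vec d => w ‖ω‖ * ‖ω‖ ^ 4)) (i j k l : Fin d) :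
    Integrable fun ω : Vec d => w ‖ω‖ * (ω i * ω j * ω k * ω l) := by
  refine integrable_radial_mul hw hi (by fun_prop) (c := 1) fun ω => ?_
  have hb : ∀ i, |ω i| ≤ ‖ω‖ := fun i => PiLp.norm_apply_le ω i
  rw [abs_mul, abs_mul, abs_mul]
  calc _ ≤ ‖ω‖ * ‖ω‖ * ‖ω‖ * ‖ω‖ := by gcongr <;> exact hb _
    _ = _ := by ring

/-- Integral of a radial weight against a quartic form. -/
theorem integral_radial_mul_quartic [NeZero d] {w : ℝ → ℝ}
    (hw : AEStronglyMeasurable (fun ω : Vec d => w ‖ω‖))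
    (hi : Integrable (fun ω : Vec d => w ‖ω‖ * ‖ω‖ ^ 4)) (T : Fin d → Fin d → Fin d → Fin d → ℝ) :
    Integrable (fun ω : Vec d =>
      w ‖ω‖ * ∑ i, ∑ j, ∑ k, ∑ l, T i j k l * (ω i * ω j * ω k * ω l)) ∧
    ∫ ω : Vec d, w ‖ω‖ * ∑ i, ∑ j, ∑ k, ∑ l, T i j k l * (ω i * ω j * ω k * ω l)
      = (∑ i, ∑ j, (T i i j j + T i j i j + T i j j i)) / (d * (d + 2))
        * ∫ ω : Vec d, w ‖ω‖ * ‖ω‖ ^ 4 := by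
  have hI := integrable_radial_mul_coords hw hi
  have h4 : ∀ i j k l : Fin d, ∫ ω : Vec d, w ‖ω‖ * (ω i * ω j * ω k * ω l)
      = ((if i = j then (1 : ℝ) else 0) * (if k = l then 1 else 0)
        + (if i = k then 1 else 0) * (if j = l then 1 else 0)
        + (if i = l then 1 else 0) * (if j = k then 1 else 0)) / (d * (d + 2))
        * ∫ ω : Vec d, w ‖ω‖ * ‖ω‖ ^ 4 := by
    intro i j k l
    have h := integral_radial_mul_inner_four hw hi (EuclideanSpace.single i 1)
      (EuclideanSpace.single j 1) (EuclideanSpace.single k 1) (EuclideanSpace.single l 1)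
    simpa only [inner_single_one, PiLp.single_apply] using h
  have hrw : ∀ ω : Vec d, w ‖ω‖ * ∑ i, ∑ j, ∑ k, ∑ l, T i j k l * (ω i * ω j * ω k * ω l)
      = ∑ i, ∑ j, ∑ k, ∑ l, T i j k l * (w ‖ω‖ * (ω i * ω j * ω k * ω l)) := by
    intro ω
    simp_rw [Finset.mul_sum, mul_left_comm (w ‖ω‖)]
  have J1 := fun i j k l => (hI i j k l).const_mul (T i j k l)
  have J2 := fun i j k => integrable_finsetSum Finset.univ fun l _ => J1 i j k l
  have J3 := fun i j => integrable_finsetSum Finset.univ fun k _ => J2 i j k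
  have J4 := fun i => integrable_finsetSum Finset.univ fun j _ => J3 i j
  simp_rw [hrw]
  refine ⟨integrable_finsetSum Finset.univ fun i _ => J4 i, ?_⟩
  rw [integral_finsetSum Finset.univ fun i _ => J4 i]
  simp_rw [integral_finsetSum Finset.univ fun j _ => J3 _ j,
    integral_finsetSum Finset.univ fun k _ => J2 _ _ k,
    integral_finsetSum Finset.univ fun l _ => J1 _ _ _ l, integral_const_mul, h4, ← mul_assoc,
    ← Finset.sum_mul, mul_div_assoc', ← Finset.sum_div]
  congr 2
  simp [mul_add, Finset.sum_add_distrib]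

end EnergyDist

/-! ### Symmetry of iterated derivatives and the `C⁵` norm -/

namespace EnergyDist

section Symmetry

variable {E F : Type*} [NormedAddCommGroup E] [NormedSpace ℝ E] [NormedAddCommGroup F]
  [NormedSpace ℝ F]

theorem iteratedFDeriv_succ_apply_fderiv {f : E → F} {n : ℕ} (hf : ContDiff ℝ (n + 1 : ℕ) f) (x : E)
    (v : Fin (n + 1) → E) : iteratedFDeriv ℝ (n + 1) f x v
      = fderiv ℝ (fun y => iteratedFDeriv ℝ n f y (Fin.tail v)) x (v 0) := by
  refine DifferentiableAt.iteratedFDeriv_succ_apply_left' ?_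
  exact hf.differentiable_iteratedFDeriv (m := n) (by exact_mod_cast Nat.lt_succ_self n) x

/-- Exchanging the two outermost directions is the symmetry of the second derivative of an `m`-th
order directional derivative; any later adjacent swap happens inside the outermost derivative and
follows by induction. -/
theorem iteratedFDeriv_comp_swap_adjacent (m : ℕ) {f : E → F} (hf : ContDiff ℝ (m + 1 : ℕ) f) (x : E)
    (v : Fin (m + 1) → E) (i : Fin m) :
    iteratedFDeriv ℝ (m + 1) f x (v ∘ Equiv.swap i.castSucc i.succ)
      = iteratedFDeriv ℝ (m + 1) f x v := by
  induction m generalizing x with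
  | zero => exact i.elim0
  | succ m ih =>
    have hf' : ContDiff ℝ (m + 1 : ℕ) f := hf.of_le (by exact_mod_cast Nat.le_succ _)
    rw [iteratedFDeriv_succ_apply_fderiv hf, iteratedFDeriv_succ_apply_fderiv hf]
    induction i using Fin.cases with
    | zero =>
      set u : Fin m → E := Fin.tail (Fin.tail v) with hu
      have h1 : ∀ y, iteratedFDeriv ℝ (m + 1) f y (Fin.tail v)
          = fderiv ℝ (fun z => iteratedFDeriv ℝ m f z u) y (v 1) := fun y => by
        rw [iteratedFDeriv_succ_apply_fderiv hf']; rfl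
      have h2 : ∀ y, iteratedFDeriv ℝ (m + 1) f y
          (Fin.tail (v ∘ Equiv.swap (Fin.castSucc 0) (Fin.succ 0)))
          = fderiv ℝ (fun z => iteratedFDeriv ℝ m f z u) y (v 0) := fun y => by
        rw [iteratedFDeriv_succ_apply_fderiv hf']
        have e1 : Fin.tail (Fin.tail (v ∘ Equiv.swap (Fin.castSucc 0) (Fin.succ 0))) = u := by
          funext j
          simp only [Fin.tail, Function.comp, hu]
          rw [Equiv.swap_apply_of_ne_of_ne]
          · simp [Fin.ext_iff]
          · simp [Fin.ext_iff]
        have e2 : Fin.tail (v ∘ Equiv.swap (Fin.castSucc 0) (Fin.succ 0)) 0 = v 0 := by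
          simp [Fin.tail]
        rw [e1, e2]
      simp_rw [h1, h2]
      have hv : (v ∘ Equiv.swap (Fin.castSucc 0) (Fin.succ 0)) 0 = v 1 := by
        simp only [Function.comp]
        congr 1
      rw [hv]
      have hG : ContDiff ℝ 2 fun z => iteratedFDeriv ℝ m f z u := by
        have h := hf.iteratedFDeriv_right (m := 2) (i := m) (by
          rw [add_comm]; norm_cast)
        exact (ContinuousMultilinearMap.apply ℝ (fun _ : Fin m => E) F u).contDiff.comp h
      have hsym : IsSymmSndFDerivAt ℝ (fun z => iteratedFDeriv ℝ m f z u) x :=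
        (hG.contDiffAt).isSymmSndFDerivAt (by simp)
      have hd : DifferentiableAt ℝ (fderiv ℝ fun z => iteratedFDeriv ℝ m f z u) x :=
        (hG.fderiv_right (m := 1) (by norm_num)).differentiable (by norm_num) x
      rw [fderiv_clm_apply hd (differentiableAt_const _),
        fderiv_clm_apply hd (differentiableAt_const _)]
      simpa using hsym (v 1) (v 0)
    | succ j =>
      have e1 : Fin.tail (v ∘ Equiv.swap j.succ.castSucc j.succ.succ)
          = Fin.tail v ∘ Equiv.swap j.castSucc j.succ := by
        funext k
        simp only [Fin.tail, Function.comp]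
        congr 1
        simp only [Equiv.swap_apply_def, ← Fin.succ_castSucc, Fin.succ_inj]
        split_ifs <;> rfl
      have e2 : (v ∘ Equiv.swap j.succ.castSucc j.succ.succ) 0 = v 0 := by
        simp only [Function.comp]
        rw [Equiv.swap_apply_of_ne_of_ne]
        · simp [Fin.ext_iff]
        · simp [Fin.ext_iff]
      rw [e1, e2]
      simp_rw [fun y => ih hf' y (Fin.tail v) j]

theorem iteratedFDeriv_comp_equiv {n : ℕ} {f : E → F} (hf : ContDiff ℝ n f) (x : E)
    (v : Fin n → E) (σ : Equiv.Perm (Fin n)) :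
    iteratedFDeriv ℝ n f x (v ∘ σ) = iteratedFDeriv ℝ n f x v := by
  cases n with
  | zero => congr 1; exact Subsingleton.elim _ _
  | succ m =>
    have hσ : σ ∈ Submonoid.closure
        (Set.range fun i : Fin m => Equiv.swap i.castSucc i.succ) := by
      rw [Equiv.Perm.mclosure_swap_castSucc_succ]; trivial
    induction hσ using Submonoid.closure_induction generalizing v with
    | mem τ hτ =>
      obtain ⟨i, rfl⟩ := hτ
      exact iteratedFDeriv_comp_swap_adjacent m hf x v i
    | one => rfl
    | mul a b _ _ ha hb =>
      have : v ∘ ⇑(a * b) = (v ∘ a) ∘ b := rfl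
      rw [this, hb, ha]

theorem iteratedDeriv_comp_smul_const {n : ℕ} {f : E → F} (hf : ContDiff ℝ n f) (θ : E) (t : ℝ) :
    iteratedDeriv n (fun s : ℝ => f (s • θ)) t = iteratedFDeriv ℝ n f (t • θ) fun _ => θ := by
  have h := ContinuousLinearMap.iteratedFDeriv_comp_right
    (ContinuousLinearMap.toSpanSingleton ℝ θ) hf t (i := n) le_rfl
  rw [iteratedDeriv]
  have h2 : (fun s : ℝ => f (s • θ)) = f ∘ ContinuousLinearMap.toSpanSingleton ℝ θ := by
    funext s; simp
  rw [h2, h]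
  simp

end Symmetry

variable {d : ℕ}

/-- `cFiveNorm` sees only nondecreasing index lists. Sorting `i` does not change the derivative, by
symmetry, so the bound extends to all lists. -/
theorem norm_iteratedFDeriv_single_le {f : Vec d → ℂ} {r M : ℝ} (hM : 0 ≤ M)
    (h : cFiveNorm r f ≤ ENNReal.ofReal M) {n : ℕ} (hn : n ≤ 5) (hf : ContDiff ℝ n f) {ω : Vec d}
    (hω : ‖ω‖ ≤ r) (i : Fin n → Fin d) :
    ‖iteratedFDeriv ℝ n f ω fun j => EuclideanSpace.single (i j) (1 : ℝ)‖ ≤ M := by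
  have hmono : ∀ i : Fin n → Fin d, Monotone i →
      ‖iteratedFDeriv ℝ n f ω fun j => EuclideanSpace.single (i j) (1 : ℝ)‖ ≤ M := by
    intro i hi
    rw [← ENNReal.ofReal_le_ofReal_iff hM, ofReal_norm]
    refine le_trans ?_ h
    unfold cFiveNorm
    refine le_trans ?_ (le_iSup₂ (f := fun (ω : Vec d) (_ : ω ∈ Metric.closedBall (0 : Vec d) r) => _)
      ω (by simpa using hω))
    classical
    refine le_trans ?_ (Finset.single_le_sum (fun _ _ => zero_le) (Finset.mem_range.2
      (Nat.lt_succ_of_le hn)))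
    exact Finset.single_le_sum (f := fun i : Fin n → Fin d =>
      ‖iteratedFDeriv ℝ n f ω fun j => EuclideanSpace.single (i j) (1 : ℝ)‖ₑ)
      (fun _ _ => zero_le) (Finset.mem_filter.2 ⟨Finset.mem_univ i, hi⟩)
  have hs := iteratedFDeriv_comp_equiv hf ω
    (fun j => EuclideanSpace.single (i j) (1 : ℝ)) (Tuple.sort i)
  rw [← hs]
  exact hmono (i ∘ Tuple.sort i) (Tuple.monotone_sort i)

/-- Expanding `θ` in the standard basis gives `d ^ n` partial derivatives, each with a coefficient
of modulus at most `1`. -/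
theorem norm_iteratedFDeriv_diag_le {f : Vec d → ℂ} {r M : ℝ} (hM : 0 ≤ M)
    (h : cFiveNorm r f ≤ ENNReal.ofReal M) {n : ℕ} (hn : n ≤ 5) (hf : ContDiff ℝ n f) {ω : Vec d}
    (hω : ‖ω‖ ≤ r) {θ : Vec d} (hθ : ‖θ‖ ≤ 1) :
    ‖iteratedFDeriv ℝ n f ω fun _ => θ‖ ≤ (d : ℝ) ^ n * M := by
  classical
  have hexp : θ = ∑ m : Fin d, θ m • EuclideanSpace.single m (1 : ℝ) := by
    ext k; simp [Pi.single_apply]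
  have h1 : iteratedFDeriv ℝ n f ω (fun _ => θ) = ∑ i : Fin n → Fin d, (∏ j, θ (i j)) •
      iteratedFDeriv ℝ n f ω fun j => EuclideanSpace.single (i j) (1 : ℝ) := by
    conv_lhs => rw [hexp]
    rw [ContinuousMultilinearMap.map_sum]
    exact Finset.sum_congr rfl fun i _ => ContinuousMultilinearMap.map_smul_univ _ _ _
  rw [h1]
  refine (norm_sum_le _ _).trans ?_
  calc _ ≤ ∑ _i : Fin n → Fin d, M := by
        refine Finset.sum_le_sum fun i _ => ?_
        rw [norm_smul]
        have : ‖∏ j, θ (i j)‖ ≤ 1 := by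
          rw [norm_prod]
          exact Finset.prod_le_one (fun _ _ => norm_nonneg _)
            fun j _ => (PiLp.norm_apply_le θ _).trans hθ
        calc _ ≤ 1 * M := mul_le_mul this (norm_iteratedFDeriv_single_le hM h hn hf hω i)
              (norm_nonneg _) zero_le_one
          _ = M := one_mul M
    _ = _ := by simp

theorem norm_le_of_cFiveNorm_le {f : Vec d → ℂ} {r M : ℝ} (hM : 0 ≤ M)
    (h : cFiveNorm r f ≤ ENNReal.ofReal M) (hf : Continuous f) {ω : Vec d} (hω : ‖ω‖ ≤ r) :
    ‖f ω‖ ≤ M := by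
  have := norm_iteratedFDeriv_single_le hM h (Nat.zero_le 5) (contDiff_zero.2 hf) hω Fin.elim0
  simpa using this

end EnergyDist

/-! ### Moments and the Taylor expansion of the quotient along rays -/

namespace EnergyDist

open MeasureTheory

variable {d : ℕ}

/-- The quadratic form of the covariance difference. -/
noncomputable def covForm (P Q : Measure (Vec d)) (ω : Vec d) : ℝ := ∑ i, ∑ j, covDiff P Q i j * (ω i * ω j)

/-- The cubic form of the difference of third central moments. -/
noncomputable def skewForm (P Q : Measure (Vec d)) (ω : Vec d) : ℝ :=
  ∑ i, ∑ j, ∑ k, skewDiff P Q i j k * (ω i * ω j * ω k)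

theorem covForm_smul (P Q : Measure (Vec d)) (t : ℝ) (ω : Vec d) :
    covForm P Q (t • ω) = t ^ 2 * covForm P Q ω := by
  simp only [covForm, Finset.mul_sum, PiLp.smul_apply, smul_eq_mul]
  refine Finset.sum_congr rfl fun i _ => Finset.sum_congr rfl fun j _ => ?_
  ring

theorem skewForm_smul (P Q : Measure (Vec d)) (t : ℝ) (ω : Vec d) :
    skewForm P Q (t • ω) = t ^ 3 * skewForm P Q ω := by
  simp only [skewForm, Finset.mul_sum, PiLp.smul_apply, smul_eq_mul]
  refine Finset.sum_congr rfl fun i _ => Finset.sum_congr rfl fun j _ =>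
    Finset.sum_congr rfl fun k _ => ?_
  ring

section Moments

variable {P : Measure (Vec d)} [IsProbabilityMeasure P]

theorem integrable_norm_sub_pow (hP : MemLp (fun x : Vec d => x) 3 P) (m : Vec d) {k : ℕ}
    (hk : k ≤ 3) : Integrable (fun x => ‖x - m‖ ^ k) P := by
  have h : MemLp (fun x : Vec d => x - m) 3 P := hP.sub (memLp_const m)
  exact (h.mono_exponent (p := (k : ℝ≥0∞)) (by exact_mod_cast hk)).integrable_norm_pow'

theorem integrable_of_abs_le_norm_sub_pow (hP : MemLp (fun x : Vec d => x) 3 P) (m : Vec d) {k : ℕ}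
    (hk : k ≤ 3) {q : Vec d → ℝ} (hq : Continuous q) (hle : ∀ x, |q x| ≤ ‖x - m‖ ^ k) :
    Integrable q P :=
  (integrable_norm_sub_pow hP m hk).mono' hq.aestronglyMeasurable (Filter.Eventually.of_forall hle)

theorem integrable_inner_pow (hP : MemLp (fun x : Vec d => x) 3 P) {θ : Vec d} (hθ : ‖θ‖ = 1)
    {k : ℕ} (hk : k ≤ 3) : Integrable (fun x => inner ℝ x θ ^ k) P := by
  refine integrable_of_abs_le_norm_sub_pow hP 0 hk (by fun_prop) fun x => ?_
  rw [abs_pow, sub_zero]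
  have := abs_real_inner_le_norm x θ
  rw [hθ, mul_one] at this
  exact pow_le_pow_left₀ (abs_nonneg _) this k

theorem inner_mean (hP : MemLp (fun x : Vec d => x) 3 P) (θ : Vec d) :
    inner ℝ (mean P) θ = ∫ x, inner ℝ x θ ∂P := by
  have hi : Integrable (fun x : Vec d => x) P := hP.integrable (by norm_num)
  rw [mean, real_inner_comm, ← integral_inner hi]
  simp_rw [real_inner_comm]

theorem sum_sub_mul_eq_inner (x m θ : Vec d) :
    ∑ i, (x i - m i) * θ i = inner ℝ x θ - inner ℝ m θ := by
  rw [← inner_sub_left, PiLp.inner_apply]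
  exact Finset.sum_congr rfl fun i _ => by simp [mul_comm]

theorem abs_coord_sub_le (x m : Vec d) (i : Fin d) : |x i - m i| ≤ ‖x - m‖ :=
  PiLp.norm_apply_le (x - m) i

theorem sum_covMatrix (hP : MemLp (fun x : Vec d => x) 3 P) {θ : Vec d} (hθ : ‖θ‖ = 1) :
    ∑ i, ∑ j, covMatrix P i j * (θ i * θ j)
      = (∫ x, inner ℝ x θ ^ 2 ∂P) - (∫ x, inner ℝ x θ ∂P) ^ 2 := by
  have hI : ∀ i j, Integrable
      (fun x : Vec d => (x i - mean P i) * (x j - mean P j) * (θ i * θ j)) P := fun i j =>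
    (integrable_of_abs_le_norm_sub_pow hP (mean P) (k := 2) (by norm_num) (by fun_prop) fun x => by
      rw [abs_mul, sq]
      exact mul_le_mul (abs_coord_sub_le _ _ _) (abs_coord_sub_le _ _ _) (abs_nonneg _)
        (norm_nonneg _)).mul_const _
  have h1 : ∑ i, ∑ j, covMatrix P i j * (θ i * θ j)
      = ∫ x, (inner ℝ x θ - inner ℝ (mean P) θ) ^ 2 ∂P := by
    simp only [covMatrix, Matrix.of_apply, ← integral_mul_const]
    simp_rw [← integral_finsetSum Finset.univ fun j _ => hI _ j]
    rw [← integral_finsetSum Finset.univ fun i _ => integrable_finsetSum _ fun j _ => hI i j]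
    refine integral_congr_ae (Filter.Eventually.of_forall fun x => ?_)
    simp only [← sum_sub_mul_eq_inner, sq, Finset.sum_mul_sum]
    exact Finset.sum_congr rfl fun i _ => Finset.sum_congr rfl fun j _ => by ring
  have i1 : Integrable (fun x : Vec d => inner ℝ x θ) P := by
    simpa using integrable_inner_pow hP hθ (k := 1) (by norm_num)
  have i2 := integrable_inner_pow hP hθ (k := 2) (by norm_num)
  rw [h1, inner_mean hP]
  set m := ∫ x, inner ℝ x θ ∂P with hm
  have h2 : ∀ x : Vec d, (inner ℝ x θ - m) ^ 2
      = inner ℝ x θ ^ 2 - 2 * m * inner ℝ x θ + m ^ 2 := fun x => by ring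
  simp_rw [h2]
  rw [integral_add (by exact i2.sub (i1.const_mul _)) (integrable_const _),
    integral_sub i2 (i1.const_mul _), integral_const_mul, ← hm]
  simp
  ring

theorem sum_thirdCentralMoment (hP : MemLp (fun x : Vec d => x) 3 P) {θ : Vec d} (hθ : ‖θ‖ = 1) :
    ∑ i, ∑ j, ∑ k, thirdCentralMoment P i j k * (θ i * θ j * θ k)
      = (∫ x, inner ℝ x θ ^ 3 ∂P) - 3 * (∫ x, inner ℝ x θ ∂P) * (∫ x, inner ℝ x θ ^ 2 ∂P)
        + 2 * (∫ x, inner ℝ x θ ∂P) ^ 3 := by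
  have hI : ∀ i j k, Integrable (fun x : Vec d =>
      (x i - mean P i) * (x j - mean P j) * (x k - mean P k) * (θ i * θ j * θ k)) P := fun i j k =>
    (integrable_of_abs_le_norm_sub_pow hP (mean P) (k := 3) le_rfl (by fun_prop) fun x => by
      rw [abs_mul, abs_mul, pow_succ, sq]
      have := abs_coord_sub_le x (mean P)
      gcongr <;> exact this _).mul_const _
  have h1 : ∑ i, ∑ j, ∑ k, thirdCentralMoment P i j k * (θ i * θ j * θ k)
      = ∫ x, (inner ℝ x θ - inner ℝ (mean P) θ) ^ 3 ∂P := by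
    simp only [thirdCentralMoment, ← integral_mul_const]
    simp_rw [← integral_finsetSum Finset.univ fun k _ => hI _ _ k]
    simp_rw [← integral_finsetSum Finset.univ fun j _ =>
      integrable_finsetSum Finset.univ fun k _ => hI _ j k]
    rw [← integral_finsetSum Finset.univ fun i _ => integrable_finsetSum _ fun j _ =>
      integrable_finsetSum Finset.univ fun k _ => hI i j k]
    refine integral_congr_ae (Filter.Eventually.of_forall fun x => ?_)
    simp only [← sum_sub_mul_eq_inner, pow_succ, pow_zero, one_mul, Finset.sum_mul_sum]
    simp only [Finset.sum_mul]
    exact Finset.sum_congr rfl fun i _ => Finset.sum_congr rfl fun j _ =>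
      Finset.sum_congr rfl fun k _ => by ring
  have i1 : Integrable (fun x : Vec d => inner ℝ x θ) P := by
    simpa using integrable_inner_pow hP hθ (k := 1) (by norm_num)
  have i2 := integrable_inner_pow hP hθ (k := 2) (by norm_num)
  have i3 := integrable_inner_pow hP hθ (k := 3) (by norm_num)
  rw [h1, inner_mean hP]
  set m := ∫ x, inner ℝ x θ ∂P with hm
  have h2 : ∀ x : Vec d, (inner ℝ x θ - m) ^ 3
      = inner ℝ x θ ^ 3 - 3 * m * inner ℝ x θ ^ 2 + 3 * m ^ 2 * inner ℝ x θ - m ^ 3 :=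
    fun x => by ring
  simp_rw [h2]
  rw [integral_sub (by exact (i3.sub (i2.const_mul _)).add (i1.const_mul _)) (integrable_const _),
    integral_add (by exact i3.sub (i2.const_mul _)) (i1.const_mul _),
    integral_sub i3 (i2.const_mul _), integral_const_mul, integral_const_mul, ← hm]
  simp
  ring

theorem contDiff_charFun_line (hP : MemLp (fun x : Vec d => x) 3 P) (θ : Vec d) {k : ℕ}
    (hk : k ≤ 3) : ContDiff ℝ k fun t : ℝ => charFun P (t • θ) := by
  have h : MemLp id k P := hP.mono_exponent (by exact_mod_cast hk)
  exact (contDiff_charFun h).comp (by fun_prop)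

theorem iteratedDeriv_charFun_line (hP : MemLp (fun x : Vec d => x) 3 P) (θ : Vec d) {k : ℕ}
    (hk : k ≤ 3) : iteratedDeriv k (fun t : ℝ => charFun P (t • θ)) 0
      = Complex.I ^ k * ((∫ x, inner ℝ x θ ^ k ∂P : ℝ) : ℂ) := by
  have h : MemLp id k P := hP.mono_exponent (by exact_mod_cast hk)
  rw [iteratedDeriv_comp_smul_const (contDiff_charFun h), iteratedFDeriv_charFun h]
  simp [← integral_complex_ofReal]

end Moments

/-- Three moments make both characteristic functions `C³`, so the Leibniz rule applies to `φ_P = φ_Q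
f` at `0` up to order three. Since `φ_Q(0) = 1`, the resulting triangular system determines the
derivatives of `f`, and raw moments recombine into differences of cumulants. -/
theorem iteratedDeriv_quotient_line {P Q : Measure (Vec d)} [IsProbabilityMeasure P]
    [IsProbabilityMeasure Q] (hP : MemLp (fun x : Vec d => x) 3 P)
    (hQ : MemLp (fun x : Vec d => x) 3 Q) {f : Vec d → ℂ} (hf : ContDiff ℝ 5 f)
    (hfPQ : ∀ ω, charFun P ω = charFun Q ω * f ω) {θ : Vec d} (hθ : ‖θ‖ = 1) :
    f 0 = 1 ∧
    iteratedDeriv 1 (fun t : ℝ => f (t • θ)) 0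
      = Complex.I * ((inner ℝ (meanDiff P Q) θ : ℝ) : ℂ) ∧
    iteratedDeriv 2 (fun t : ℝ => f (t • θ)) 0
      = ((-(inner ℝ (meanDiff P Q) θ ^ 2 + covForm P Q θ) : ℝ) : ℂ) ∧
    iteratedDeriv 3 (fun t : ℝ => f (t • θ)) 0
      = Complex.I * ((-(inner ℝ (meanDiff P Q) θ ^ 3 + skewForm P Q θ
          + 3 * inner ℝ (meanDiff P Q) θ * covForm P Q θ) : ℝ) : ℂ) := by
  set g := fun t : ℝ => f (t • θ) with hg
  have hgc : ∀ k : ℕ, k ≤ 3 → ContDiff ℝ k g := fun k hk =>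
    (hf.of_le (by exact_mod_cast hk.trans (by norm_num))).comp (by fun_prop)
  have hf0 : f 0 = 1 := by simpa using (hfPQ 0).symm
  have hprod : (fun t : ℝ => charFun P (t • θ)) = (fun t : ℝ => charFun Q (t • θ)) * g := by
    funext t; exact hfPQ _
  have hL : ∀ k : ℕ, k ≤ 3 → _ := fun k hk =>
    iteratedDeriv_mul (n := k) (x := 0) (contDiff_charFun_line hQ θ hk).contDiffAt
      (hgc k hk).contDiffAt
  rw [← hprod] at hL
  have hP' := fun k hk => iteratedDeriv_charFun_line (k := k) hP θ hk
  have hQ' := fun k hk => iteratedDeriv_charFun_line (k := k) hQ θ hk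
  have hg0 : g 0 = 1 := by simp [hg, hf0]
  have hmean : inner ℝ (meanDiff P Q) θ = (∫ x, inner ℝ x θ ∂P) - ∫ x, inner ℝ x θ ∂Q := by
    rw [meanDiff, inner_sub_left, inner_mean hP, inner_mean hQ]
  have hcov : covForm P Q θ = ((∫ x, inner ℝ x θ ^ 2 ∂P) - (∫ x, inner ℝ x θ ∂P) ^ 2)
      - ((∫ x, inner ℝ x θ ^ 2 ∂Q) - (∫ x, inner ℝ x θ ∂Q) ^ 2) := by
    rw [← sum_covMatrix hP hθ, ← sum_covMatrix hQ hθ]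
    simp only [covForm, covDiff, Matrix.sub_apply, sub_mul, Finset.sum_sub_distrib]
  have hskew : skewForm P Q θ = ((∫ x, inner ℝ x θ ^ 3 ∂P)
        - 3 * (∫ x, inner ℝ x θ ∂P) * (∫ x, inner ℝ x θ ^ 2 ∂P) + 2 * (∫ x, inner ℝ x θ ∂P) ^ 3)
      - ((∫ x, inner ℝ x θ ^ 3 ∂Q)
        - 3 * (∫ x, inner ℝ x θ ∂Q) * (∫ x, inner ℝ x θ ^ 2 ∂Q) + 2 * (∫ x, inner ℝ x θ ∂Q) ^ 3) := by
    rw [← sum_thirdCentralMoment hP hθ, ← sum_thirdCentralMoment hQ hθ]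
    simp only [skewForm, skewDiff, sub_mul, Finset.sum_sub_distrib]
  have e1 := hL 1 (by norm_num)
  have e2 := hL 2 (by norm_num)
  have e3 := hL 3 (by norm_num)
  rw [hP' 1 (by norm_num)] at e1
  rw [hP' 2 (by norm_num)] at e2
  rw [hP' 3 (by norm_num)] at e3
  simp only [Finset.sum_range_succ, Finset.range_zero, Finset.sum_empty, zero_add] at e1 e2 e3
  rw [hQ' 0 (by norm_num), hQ' 1 (by norm_num)] at e1
  rw [hQ' 0 (by norm_num), hQ' 1 (by norm_num), hQ' 2 (by norm_num)] at e2
  rw [hQ' 0 (by norm_num), hQ' 1 (by norm_num), hQ' 2 (by norm_num), hQ' 3 (by norm_num)] at e3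
  have c1 : Nat.choose 3 1 = 3 := rfl
  have c2 : Nat.choose 3 2 = 3 := rfl
  have c3 : Nat.choose 2 1 = 2 := rfl
  have hI3 : Complex.I ^ 3 = -Complex.I := Complex.I_pow_three
  simp only [Nat.choose_zero_right, Nat.choose_self, c1, c2, c3, Nat.sub_zero, Nat.sub_self,
    Nat.reduceSub, iteratedDeriv_zero, hg0, pow_zero, pow_one, Complex.I_sq, hI3, integral_const,
    probReal_univ, smul_eq_mul, mul_one, one_mul, Nat.cast_one, Complex.ofReal_one,
    Nat.cast_ofNat] at e1 e2 e3
  rw [hmean, hcov, hskew]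
  generalize (∫ x, inner ℝ x θ ∂P) = p1 at *
  generalize (∫ x, inner ℝ x θ ^ 2 ∂P) = p2 at *
  generalize (∫ x, inner ℝ x θ ^ 3 ∂P) = p3 at *
  generalize (∫ x, inner ℝ x θ ∂Q) = q1 at *
  generalize (∫ x, inner ℝ x θ ^ 2 ∂Q) = q2 at *
  generalize (∫ x, inner ℝ x θ ^ 3 ∂Q) = q3 at *
  have r1 : iteratedDeriv 1 g 0 = Complex.I * ((p1 - q1 : ℝ) : ℂ) := by
    push_cast; linear_combination -e1
  have hII : Complex.I * Complex.I = -1 := Complex.I_mul_I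
  have r2 : iteratedDeriv 2 g 0 = ((-((p1 - q1) ^ 2 + (p2 - p1 ^ 2 - (q2 - q1 ^ 2))) : ℝ) : ℂ) := by
    rw [r1] at e2
    push_cast at e2 ⊢
    linear_combination -e2 - 2 * (q1 : ℂ) * (p1 - q1) * hII
  refine ⟨hf0, r1, r2, ?_⟩
  rw [r1, r2] at e3
  push_cast at e3 ⊢
  linear_combination -e3

/-- Third order Taylor expansion of the quotient of characteristic functions along a line. -/
theorem norm_quotient_line_sub_taylor_le {P Q : Measure (Vec d)} [IsProbabilityMeasure P]
    [IsProbabilityMeasure Q] (hP : MemLp (fun x : Vec d => x) 3 P)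
    (hQ : MemLp (fun x : Vec d => x) 3 Q) {f : Vec d → ℂ} (hf : ContDiff ℝ 5 f)
    (hfPQ : ∀ ω, charFun P ω = charFun Q ω * f ω) {θ : Vec d} (hθ : ‖θ‖ = 1) {M : ℝ} (hd : 0 < d)
    (hM : 0 ≤ M) (h : cFiveNorm 1 f ≤ ENNReal.ofReal M) {a b c : ℝ}
    (ha : a = inner ℝ (meanDiff P Q) θ)
    (hb : b = -(inner ℝ (meanDiff P Q) θ ^ 2 + covForm P Q θ) / 2)
    (hc : c = -(inner ℝ (meanDiff P Q) θ ^ 3 + skewForm P Q θ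
          + 3 * inner ℝ (meanDiff P Q) θ * covForm P Q θ) / 6) :
    |a| ≤ d ^ 4 * M ∧ |b| ≤ d ^ 4 * M ∧ |c| ≤ d ^ 4 * M ∧ ∀ t ∈ Set.Icc (0 : ℝ) 1,
      ‖f (t • θ) - (1 + Complex.I * a * t + b * t ^ 2 + Complex.I * c * t ^ 3)‖
        ≤ d ^ 4 * M * t ^ 4 := by
  obtain ⟨h0, h1, h2, h3⟩ := iteratedDeriv_quotient_line hP hQ hf hfPQ hθ
  have hd1 : (1 : ℝ) ≤ d := by exact_mod_cast hd
  set g := fun t : ℝ => f (t • θ) with hg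
  have hfk : ∀ k : ℕ, k ≤ 5 → ContDiff ℝ k f := fun k hk => hf.of_le (by exact_mod_cast hk)
  have hbound : ∀ k : ℕ, k ≤ 4 → ∀ t ∈ Set.Icc (0 : ℝ) 1, ‖iteratedDeriv k g t‖ ≤ d ^ 4 * M := by
    intro k hk t ht
    have hk5 : k ≤ 5 := hk.trans (by norm_num)
    rw [hg, iteratedDeriv_comp_smul_const (hfk k hk5)]
    refine (norm_iteratedFDeriv_diag_le hM h hk5 (hfk k hk5) ?_ hθ.le).trans ?_
    · rw [norm_smul, hθ, mul_one, Real.norm_eq_abs, abs_of_nonneg ht.1]; exact ht.2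
    · exact mul_le_mul_of_nonneg_right (pow_le_pow_right₀ hd1 hk) hM
  have hz : (0 : ℝ) ∈ Set.Icc (0 : ℝ) 1 := by simp
  have k1 := hbound 1 (by norm_num) 0 hz
  have k2 := hbound 2 (by norm_num) 0 hz
  have k3 := hbound 3 (by norm_num) 0 hz
  rw [h1] at k1
  rw [h2] at k2
  rw [h3] at k3
  simp only [norm_mul, Complex.norm_I, one_mul, Complex.norm_real, Real.norm_eq_abs] at k1 k2 k3
  have hdM : 0 ≤ (d : ℝ) ^ 4 * M := by positivity
  refine ⟨by rwa [ha], ?_, ?_, fun t ht => ?_⟩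
  · rw [hb, abs_div, abs_of_pos (by norm_num : (0 : ℝ) < 2)]; linarith
  · rw [hc, abs_div, abs_of_pos (by norm_num : (0 : ℝ) < 6)]; linarith
  · have hgc : ContDiff ℝ 5 g := hf.comp (by fun_prop)
    have hud : UniqueDiffOn ℝ (Set.Icc (0 : ℝ) 1) := uniqueDiffOn_Icc zero_lt_one
    have heq : ∀ k : ℕ, k ≤ 5 → ∀ y ∈ Set.Icc (0 : ℝ) 1,
        iteratedDerivWithin k g (Set.Icc 0 1) y = iteratedDeriv k g y := fun k hk y hy =>
      iteratedDerivWithin_eq_iteratedDeriv hud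
        (hgc.of_le (by exact_mod_cast hk)).contDiffAt hy
    -- Only `f` need have a fourth derivative here; the characteristic functions themselves may be
    -- no better than `C³`.
    have hT := taylor_mean_remainder_bound (f := g) (a := 0) (b := 1) (C := d ^ 4 * M) (x := t)
      (n := 3) zero_le_one (hgc.of_le (by norm_num)).contDiffOn ht
      (fun y hy => by rw [heq _ (by norm_num) y hy]; exact hbound _ le_rfl y hy)
    rw [taylorWithinEval_succ, taylorWithinEval_succ, taylorWithinEval_succ,
      taylor_within_zero_eval, heq _ (by norm_num) 0 hz, heq _ (by norm_num) 0 hz,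
      heq _ (by norm_num) 0 hz] at hT
    norm_num [h1, h2, h3, Nat.factorial] at hT
    have hg0 : g 0 = 1 := by simp [hg, h0]
    rw [hg0] at hT
    have hle : d ^ 4 * M * t ^ 4 / 6 ≤ d ^ 4 * M * t ^ 4 := by
      have : 0 ≤ d ^ 4 * M * t ^ 4 := by positivity
      linarith
    refine le_trans (le_of_eq ?_) (hT.trans hle)
    congr 1
    rw [ha, hb, hc]
    simp only [hg]
    push_cast
    ring

end EnergyDist

/-! ### Expansion of `‖f - 1‖² / ‖f‖` with a uniform remainder -/

namespace EnergyDist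

open MeasureTheory

/-- Compactness of the box replaces explicit constants: remainders below are polynomials in bounded
parameters. -/
theorem exists_bound_of_continuous_pi {n : ℕ} {G : (Fin n → ℝ) → ℝ} (hG : Continuous G) (M : ℝ) :
    ∃ C, 0 ≤ C ∧ ∀ v : Fin n → ℝ, (∀ i, |v i| ≤ M) → |G v| ≤ C := by
  obtain ⟨C, hC⟩ := (isCompact_univ_pi (fun _ : Fin n => isCompact_Icc (a := -M) (b := M))
    ).exists_bound_of_continuousOn hG.continuousOn
  refine ⟨max C 0, le_max_right _ _, fun v hv => le_max_of_le_left (hC v ?_)⟩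
  exact fun i _ => abs_le.1 (hv i)

/-- Expansion of `‖z - 1‖² / ‖z‖` for `z` given by a third order expansion at `1`. -/
theorem exists_norm_sub_one_sq_div_norm_expansion (M : ℝ) :
    ∃ C, 0 ≤ C ∧ ∀ a b c : ℝ, |a| ≤ M → |b| ≤ M → |c| ≤ M →
      |a ^ 2| ≤ C ∧ |b ^ 2 + 2 * a * c - (b + a ^ 2 / 2) * a ^ 2| ≤ C ∧
      ∀ t ∈ Set.Icc (0 : ℝ) 1, ∀ z : ℂ, z ≠ 0 → ‖z‖⁻¹ ≤ M →
        ‖z - (1 + Complex.I * a * t + b * t ^ 2 + Complex.I * c * t ^ 3)‖ ≤ M * t ^ 4 →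
        |‖z - 1‖ ^ 2 / ‖z‖
          - (a ^ 2 * t ^ 2 + (b ^ 2 + 2 * a * c - (b + a ^ 2 / 2) * a ^ 2) * t ^ 4)|
          ≤ C * t ^ 5 := by
  -- With `x`, `y` the real and imaginary remainders divided by `t⁴` and `s = ‖z‖`: `s² = 1 + t²
  -- R1`, `R1 = 2b + a² + t² R2`, `‖z - 1‖² = a²t² + (b² + 2ac) t⁴ + t⁵ R3`, `s = 1 + (b + a²/2) t²
  -- + t⁴ E`, and `G` is the coefficient of `t⁵` left after subtracting `s` times the expected
  -- expansion from `‖z - 1‖²`.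
  let R1 : ℝ → ℝ → ℝ → ℝ → ℝ → ℝ → ℝ := fun a b c x y t =>
    2 * b + 2 * x * t ^ 2 + t ^ 2 * (b + x * t ^ 2) ^ 2 + (a + c * t ^ 2 + y * t ^ 3) ^ 2
  let R2 : ℝ → ℝ → ℝ → ℝ → ℝ → ℝ → ℝ := fun a b c x y t =>
    2 * x + (b + x * t ^ 2) ^ 2 + 2 * a * (c + y * t) + t ^ 2 * (c + y * t) ^ 2
  let R3 : ℝ → ℝ → ℝ → ℝ → ℝ → ℝ → ℝ := fun a b c x y t =>
    2 * b * x * t + x ^ 2 * t ^ 3 + 2 * a * y + t * (c + y * t) ^ 2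
  let E : ℝ → ℝ → ℝ → ℝ → ℝ → ℝ → ℝ → ℝ := fun a b c x y t σ =>
    R2 a b c x y t / 2 - R1 a b c x y t ^ 2 * σ ^ 2 / 2
  let q : ℝ → ℝ → ℝ → ℝ := fun a b c => b ^ 2 + 2 * a * c - (b + a ^ 2 / 2) * a ^ 2
  let G : ℝ → ℝ → ℝ → ℝ → ℝ → ℝ → ℝ → ℝ := fun a b c x y t σ =>
    R3 a b c x y t - t * (b + a ^ 2 / 2) * q a b c
      - t * E a b c x y t σ * (a ^ 2 + q a b c * t ^ 2)
  set N := max M 1 with hN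
  have hMN : M ≤ N := le_max_left _ _
  have hN1 : 1 ≤ N := le_max_right _ _
  obtain ⟨C1, hC1, h1⟩ := exists_bound_of_continuous_pi (n := 7)
    (G := fun v => G (v 0) (v 1) (v 2) (v 3) (v 4) (v 5) (v 6)) (by fun_prop) N
  obtain ⟨C2, hC2, h2⟩ := exists_bound_of_continuous_pi (n := 3)
    (G := fun v => q (v 0) (v 1) (v 2)) (by fun_prop) N
  have hC : C1 * N + C2 + N ^ 2 ≥ 0 := by positivity
  refine ⟨C1 * N + C2 + N ^ 2, hC, fun a b c ha hb hc => ⟨?_, ?_, ?_⟩⟩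
  · rw [abs_pow]
    have := pow_le_pow_left₀ (abs_nonneg a) (ha.trans hMN) 2
    have : 0 ≤ C1 * N := by positivity
    linarith
  · have := h2 ![a, b, c] (by simp [Fin.forall_fin_succ, ha.trans hMN, hb.trans hMN, hc.trans hMN])
    simp only [Matrix.cons_val, q] at this
    have : 0 ≤ C1 * N := by positivity
    nlinarith [sq_nonneg N]
  · intro t ht z hz hzM hexp
    have ht0 := ht.1
    have ht1 := ht.2
    rcases ht0.eq_or_lt with rfl | htpos
    · have : z = 1 := by simpa [sub_eq_zero] using hexp
      simp [this]
    set ρ := z - (1 + Complex.I * a * t + b * t ^ 2 + Complex.I * c * t ^ 3) with hρ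
    have ht4 : 0 < t ^ 4 := by positivity
    obtain ⟨x, hx⟩ : ∃ x, x = ρ.re / t ^ 4 := ⟨_, rfl⟩
    obtain ⟨y, hy⟩ : ∃ y, y = ρ.im / t ^ 4 := ⟨_, rfl⟩
    have hxM : |x| ≤ M := by
      rw [hx, abs_div, abs_of_pos ht4, div_le_iff₀ ht4]
      exact (Complex.abs_re_le_norm ρ).trans hexp
    have hyM : |y| ≤ M := by
      rw [hy, abs_div, abs_of_pos ht4, div_le_iff₀ ht4]
      exact (Complex.abs_im_le_norm ρ).trans hexp
    have hre : z.re = 1 + b * t ^ 2 + x * t ^ 4 := by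
      have : ρ.re = x * t ^ 4 := by rw [hx]; field_simp
      rw [← this, hρ]
      simp [← Complex.ofReal_pow]
    have him : z.im = a * t + c * t ^ 3 + y * t ^ 4 := by
      have : ρ.im = y * t ^ 4 := by rw [hy]; field_simp
      rw [← this, hρ]
      simp [← Complex.ofReal_pow]
    set s := ‖z‖ with hs
    have hspos : 0 < s := norm_pos_iff.2 hz
    -- Using `s - 1 = (s² - 1) σ` with `0 < σ ≤ 1` keeps all parameters of `G` in a fixed box and
    -- avoids expanding the square root.
    set σ := 1 / (s + 1) with hσ
    have hσ0 : 0 < σ := by positivity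
    have hσ1 : σ ≤ 1 := by rw [hσ, div_le_one (by linarith)]; linarith
    have hs2 : s ^ 2 = 1 + t ^ 2 * R1 a b c x y t := by
      rw [hs, ← Complex.normSq_eq_norm_sq, Complex.normSq_apply, hre, him]
      simp only [R1]; ring
    have hR12 : R1 a b c x y t = 2 * b + a ^ 2 + t ^ 2 * R2 a b c x y t := by
      simp only [R1, R2]; ring
    have hs1 : s - 1 = t ^ 2 * R1 a b c x y t * σ := by
      rw [hσ, mul_one_div, eq_div_iff (by positivity)]; linarith
    have hsE : s = 1 + (b + a ^ 2 / 2) * t ^ 2 + t ^ 4 * E a b c x y t σ := by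
      have e1 : s - 1 = (s ^ 2 - 1) / 2 - (s - 1) ^ 2 / 2 := by ring
      rw [hs2, hs1] at e1
      have e2 : s - 1 = (b + a ^ 2 / 2) * t ^ 2 + t ^ 4 * E a b c x y t σ := by
        rw [hs1, e1]
        simp only [E]
        linear_combination t ^ 2 / 2 * hR12
      linarith
    have hN2 : ‖z - 1‖ ^ 2 = a ^ 2 * t ^ 2 + (b ^ 2 + 2 * a * c) * t ^ 4
        + t ^ 5 * R3 a b c x y t := by
      rw [← Complex.normSq_eq_norm_sq, Complex.normSq_apply]
      simp only [Complex.sub_re, Complex.sub_im, Complex.one_re, Complex.one_im, hre, him, R3]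
      ring
    have hmain : ‖z - 1‖ ^ 2 / s - (a ^ 2 * t ^ 2 + q a b c * t ^ 4)
        = t ^ 5 * G a b c x y t σ * s⁻¹ := by
      have : ‖z - 1‖ ^ 2 - s * (a ^ 2 * t ^ 2 + q a b c * t ^ 4) = t ^ 5 * G a b c x y t σ := by
        rw [hN2]
        nth_rewrite 1 [hsE]
        simp only [G, q]
        ring
      rw [← this]
      field_simp
    have hG := h1 ![a, b, c, x, y, t, σ] (by
      simp [Fin.forall_fin_succ, ha.trans hMN, hb.trans hMN, hc.trans hMN, hxM.trans hMN,
        hyM.trans hMN, abs_of_pos htpos, abs_of_pos hσ0, ht1.trans hN1, hσ1.trans hN1])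
    simp only [Matrix.cons_val] at hG
    change |‖z - 1‖ ^ 2 / s - (a ^ 2 * t ^ 2 + q a b c * t ^ 4)| ≤ _
    rw [hmain]
    generalize G a b c x y t σ = Gv at hG
    rw [ abs_mul, abs_mul, abs_of_pos (show 0 < t ^ 5 by positivity),
      abs_of_pos (inv_pos.2 hspos)]
    calc t ^ 5 * |Gv| * s⁻¹ ≤ t ^ 5 * C1 * N := by
          gcongr
          exact hzM.trans hMN
      _ ≤ (C1 * N + C2 + N ^ 2) * t ^ 5 := by
          rw [show (C1 * N + C2 + N ^ 2) * t ^ 5 = t ^ 5 * C1 * N + (C2 + N ^ 2) * t ^ 5 by ring]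
          exact le_add_of_nonneg_right (by positivity)

variable {d : ℕ}

/-- The quartic form in the expansion of `‖f - 1‖² / ‖f‖`. -/
noncomputable def quarticForm (P Q : Measure (Vec d)) (ω : Vec d) : ℝ :=
  covForm P Q ω ^ 2 / 4 - inner ℝ (meanDiff P Q) ω * skewForm P Q ω / 3
    - inner ℝ (meanDiff P Q) ω ^ 4 / 12

theorem quarticForm_smul (P Q : Measure (Vec d)) (t : ℝ) (ω : Vec d) :
    quarticForm P Q (t • ω) = t ^ 4 * quarticForm P Q ω := by
  simp only [quarticForm, covForm_smul, skewForm_smul, real_inner_smul_right]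
  ring

/-- Expansion of `‖f - 1‖² / ‖f‖` for a quotient `f` of characteristic functions, with a remainder
bounded in terms of the `C⁵` bound `B` of `f` and `f⁻¹`. -/
theorem exists_quotient_expansion (hd : 0 < d) (B : ℝ → ℝ≥0) :
    ∃ C, 0 ≤ C ∧ ∀ (P Q : Measure (Vec d)) (f g : Vec d → ℂ), IsProbabilityMeasure P →
      IsProbabilityMeasure Q → MemLp (fun x : Vec d => x) 3 P → MemLp (fun x : Vec d => x) 3 Q →
      ContDiff ℝ 5 f → ContDiff ℝ 5 g → (∀ ω, charFun P ω = charFun Q ω * f ω) →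
      (∀ ω, f ω * g ω = 1) → (∀ r : ℝ, 0 ≤ r → cFiveNorm r f + cFiveNorm r g ≤ (B r : ℝ≥0∞)) →
      ∀ ω : Vec d, 1 ≤ (B ‖ω‖ : ℝ) ∧ |‖f ω - 1‖ ^ 2 / ‖f ω‖
        - (inner ℝ (meanDiff P Q) ω ^ 2 + quarticForm P Q ω)| ≤ C * (‖ω‖ ^ 5 * B ‖ω‖) := by
  set M : ℝ := (d : ℝ) ^ 4 * B 1 with hMdef
  obtain ⟨C, hC0, hC⟩ := exists_norm_sub_one_sq_div_norm_expansion M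
  -- For `‖ω‖ ≥ 1` the quotient is at most `4 B(‖ω‖)`, and the quadratic and quartic terms
  -- contribute one `C` each; for `‖ω‖ ≤ 1` a single `C` suffices.
  refine ⟨2 * C + 4, by positivity, ?_⟩
  intro P Q f g _ _ hP hQ hf hg hfPQ hfg hB ω
  have hd1 : (1 : ℝ) ≤ d := by exact_mod_cast hd
  have hBr : ∀ r : ℝ, ((B r : ℝ≥0) : ℝ≥0∞) = ENNReal.ofReal (B r : ℝ) := fun r => by simp
  have hBf : ∀ r : ℝ, 0 ≤ r → cFiveNorm r f ≤ ENNReal.ofReal (B r : ℝ) := fun r hr =>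
    (le_self_add.trans (hB r hr)).trans_eq (hBr r)
  have hBg : ∀ r : ℝ, 0 ≤ r → cFiveNorm r g ≤ ENNReal.ofReal (B r : ℝ) := fun r hr =>
    (le_add_self.trans (hB r hr)).trans_eq (hBr r)
  have hne : ∀ ω, f ω ≠ 0 := fun ω h0 => by simpa [h0] using hfg ω
  have hinv : ∀ ω, ‖g ω‖ = ‖f ω‖⁻¹ := fun ω => by
    rw [← norm_inv]; congr 1; exact eq_inv_of_mul_eq_one_right (hfg ω)
  have hfle : ∀ r : ℝ, 0 ≤ r → ∀ ω : Vec d, ‖ω‖ ≤ r → ‖f ω‖ ≤ B r := fun r hr ω hω =>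
    norm_le_of_cFiveNorm_le (B r).2 (hBf r hr) hf.continuous hω
  have hgle : ∀ r : ℝ, 0 ≤ r → ∀ ω : Vec d, ‖ω‖ ≤ r → ‖f ω‖⁻¹ ≤ B r := fun r hr ω hω => by
    rw [← hinv]; exact norm_le_of_cFiveNorm_le (B r).2 (hBg r hr) hg.continuous hω
  have hB1 : ∀ r : ℝ, 0 ≤ r → 1 ≤ (B r : ℝ) := fun r hr => by
    have h0 : f 0 = 1 := by simpa using (hfPQ 0).symm
    simpa [h0] using hfle r hr 0 (by simpa using hr)
  refine ⟨hB1 _ (norm_nonneg _), ?_⟩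
  have key : ∀ θ : Vec d, ‖θ‖ = 1 →
      inner ℝ (meanDiff P Q) θ ^ 2 ≤ C ∧ |quarticForm P Q θ| ≤ C ∧
      ∀ t ∈ Set.Icc (0 : ℝ) 1, |‖f (t • θ) - 1‖ ^ 2 / ‖f (t • θ)‖
        - (inner ℝ (meanDiff P Q) θ ^ 2 * t ^ 2 + quarticForm P Q θ * t ^ 4)| ≤ C * t ^ 5 := by
    intro θ hθ
    obtain ⟨ha, hb, hc, hT⟩ := norm_quotient_line_sub_taylor_le hP hQ hf hfPQ hθ hd (B 1).2
      (hBf 1 zero_le_one) rfl rfl rfl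
    obtain ⟨k1, k2, k3⟩ := hC _ _ _ ha hb hc
    -- The mixed terms `m² D` cancel when the coefficients of `f` are inserted.
    have hq : ∀ m D κ : ℝ, (-(m ^ 2 + D) / 2) ^ 2 + 2 * m * (-(m ^ 3 + κ + 3 * m * D) / 6)
        - (-(m ^ 2 + D) / 2 + m ^ 2 / 2) * m ^ 2 = D ^ 2 / 4 - m * κ / 3 - m ^ 4 / 12 := by
      intro m D κ; ring
    simp only [hq] at k2 k3
    refine ⟨le_of_abs_le k1, k2, fun t ht => k3 t ht (f (t • θ)) (hne _) ?_ (hT t ht)⟩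
    have ht1 : ‖t • θ‖ ≤ 1 := by
      rw [norm_smul, hθ, mul_one, Real.norm_eq_abs, abs_of_nonneg ht.1]; exact ht.2
    exact (hgle 1 zero_le_one _ ht1).trans
      (le_mul_of_one_le_left (B 1).2 (one_le_pow₀ hd1))
  have hω0 : 0 ≤ ‖ω‖ := norm_nonneg ω
  obtain ⟨θ, hθ, hωθ⟩ : ∃ θ : Vec d, ‖θ‖ = 1 ∧ ω = ‖ω‖ • θ := by
    by_cases h0 : ω = 0
    · exact ⟨EuclideanSpace.single ⟨0, hd⟩ 1, by simp, by simp [h0]⟩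
    · have : ‖ω‖ ≠ 0 := norm_ne_zero_iff.2 h0
      exact ⟨‖ω‖⁻¹ • ω, by rw [norm_smul, norm_inv, norm_norm, inv_mul_cancel₀ this],
        by rw [smul_smul, mul_inv_cancel₀ this, one_smul]⟩
  obtain ⟨k1, k2, k3⟩ := key θ hθ
  have hin : inner ℝ (meanDiff P Q) ω ^ 2 = inner ℝ (meanDiff P Q) θ ^ 2 * ‖ω‖ ^ 2 := by
    conv_lhs => rw [hωθ, real_inner_smul_right]
    ring
  have hqu : quarticForm P Q ω = quarticForm P Q θ * ‖ω‖ ^ 4 := by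
    conv_lhs => rw [hωθ, quarticForm_smul]
    ring
  rw [hin, hqu]
  have hBω := hB1 _ hω0
  by_cases h1 : ‖ω‖ ≤ 1
  · have h := k3 ‖ω‖ ⟨hω0, h1⟩
    rw [← hωθ] at h
    refine h.trans ?_
    have h5 : 0 ≤ ‖ω‖ ^ 5 := by positivity
    have h6 : ‖ω‖ ^ 5 ≤ ‖ω‖ ^ 5 * B ‖ω‖ := le_mul_of_one_le_right h5 hBω
    calc C * ‖ω‖ ^ 5 ≤ C * (‖ω‖ ^ 5 * B ‖ω‖) := by gcongr
      _ ≤ (2 * C + 4) * (‖ω‖ ^ 5 * B ‖ω‖) := by gcongr; linarith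
  · have h1 : 1 ≤ ‖ω‖ := (not_le.1 h1).le
    have hF : ‖f ω - 1‖ ^ 2 / ‖f ω‖ ≤ 4 * B ‖ω‖ := by
      have hp : 0 < ‖f ω‖ := norm_pos_iff.2 (hne ω)
      have e1 : ‖f ω - 1‖ ≤ ‖f ω‖ + 1 := (norm_sub_le _ _).trans (by simp)
      have e2 : ‖f ω - 1‖ ^ 2 / ‖f ω‖ ≤ (‖f ω‖ + 1) ^ 2 / ‖f ω‖ := by gcongr
      have e3 : (‖f ω‖ + 1) ^ 2 / ‖f ω‖ = ‖f ω‖ + 2 + ‖f ω‖⁻¹ := by field_simp; ring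
      have := hfle _ hω0 ω le_rfl
      have := hgle _ hω0 ω le_rfl
      linarith
    have hF0 : 0 ≤ ‖f ω - 1‖ ^ 2 / ‖f ω‖ := by positivity
    have p0 : 1 ≤ ‖ω‖ ^ 5 := one_le_pow₀ h1
    have p2 : ‖ω‖ ^ 2 ≤ ‖ω‖ ^ 5 := pow_le_pow_right₀ h1 (by norm_num)
    have p4 : ‖ω‖ ^ 4 ≤ ‖ω‖ ^ 5 := pow_le_pow_right₀ h1 (by norm_num)
    have q1 : |inner ℝ (meanDiff P Q) θ ^ 2 * ‖ω‖ ^ 2| ≤ C * (‖ω‖ ^ 5 * B ‖ω‖) := by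
      rw [abs_of_nonneg (by positivity)]
      exact mul_le_mul k1 (p2.trans (le_mul_of_one_le_right (by positivity) hBω)) (by positivity) hC0
    have q2 : |quarticForm P Q θ * ‖ω‖ ^ 4| ≤ C * (‖ω‖ ^ 5 * B ‖ω‖) := by
      rw [abs_mul, abs_of_nonneg (show 0 ≤ ‖ω‖ ^ 4 by positivity)]
      exact mul_le_mul k2 (p4.trans (le_mul_of_one_le_right (by positivity) hBω)) (by positivity) hC0
    have q3 : |‖f ω - 1‖ ^ 2 / ‖f ω‖| ≤ 4 * (‖ω‖ ^ 5 * B ‖ω‖) := by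
      rw [abs_of_nonneg hF0]
      have : (B ‖ω‖ : ℝ) ≤ ‖ω‖ ^ 5 * B ‖ω‖ := le_mul_of_one_le_left (by positivity) p0
      linarith
    have t1 := abs_sub (‖f ω - 1‖ ^ 2 / ‖f ω‖)
      (inner ℝ (meanDiff P Q) θ ^ 2 * ‖ω‖ ^ 2 + quarticForm P Q θ * ‖ω‖ ^ 4)
    have t2 := abs_add_le (inner ℝ (meanDiff P Q) θ ^ 2 * ‖ω‖ ^ 2) (quarticForm P Q θ * ‖ω‖ ^ 4)
    linarith

end EnergyDist

/-! ### Gamma ratios and the dimensional constants -/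

namespace EnergyDist

open MeasureTheory Real Set

/-- Log-convexity of `Γ` at the midpoint of `x` and `x + 1`. -/
theorem sq_Gamma_add_half_le {x : ℝ} (hx : 0 < x) : Gamma (x + 1 / 2) ^ 2 ≤ x * Gamma x ^ 2 := by
  have h := Real.Gamma_mul_add_mul_le_rpow_Gamma_mul_rpow_Gamma hx (show 0 < x + 1 by linarith)
    (show (0 : ℝ) < 1 / 2 by norm_num) (show (0 : ℝ) < 1 / 2 by norm_num) (by norm_num)
  have hG := Gamma_pos_of_pos hx
  rw [Real.Gamma_add_one hx.ne', ← Real.sqrt_eq_rpow, ← Real.sqrt_eq_rpow] at h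
  rw [show 1 / 2 * x + 1 / 2 * (x + 1) = x + 1 / 2 by ring] at h
  have h2 := pow_le_pow_left₀ (Gamma_pos_of_pos (show 0 < x + 1 / 2 by linarith)).le h 2
  rw [mul_pow, Real.sq_sqrt hG.le, Real.sq_sqrt (by positivity)] at h2
  linarith

/-- The upper bound at `x - 1/2`, turned into a lower bound by the functional equation. -/
theorem mul_sq_Gamma_le {x : ℝ} (hx : 1 / 2 < x) :
    (x - 1 / 2) * Gamma x ^ 2 ≤ Gamma (x + 1 / 2) ^ 2 := by
  have hx' : 0 < x - 1 / 2 := by linarith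
  have h := sq_Gamma_add_half_le hx'
  rw [sub_add_cancel] at h
  have h1 : Gamma (x + 1 / 2) = (x - 1 / 2) * Gamma (x - 1 / 2) := by
    rw [← Real.Gamma_add_one hx'.ne']; congr 1; ring
  rw [h1]
  calc (x - 1 / 2) * Gamma x ^ 2 ≤ (x - 1 / 2) * ((x - 1 / 2) * Gamma (x - 1 / 2) ^ 2) := by gcongr
    _ = _ := by ring

/-- The dimensional correction `1 + ε₁(d)` of the first order coefficient. -/
noncomputable def gammaRatio (d : ℕ) : ℝ :=
  Gamma (((d : ℝ) + 1) / 2) / Gamma ((d : ℝ) / 2) * √(2 / d)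

theorem abs_gammaRatio_sub_one_le {d : ℕ} (hd : 1 < d) : |gammaRatio d - 1| ≤ 1 / d := by
  have hd1 : (1 : ℝ) < d := by exact_mod_cast hd
  have hd0 : (0 : ℝ) < d := by linarith
  have hx : (0 : ℝ) < (d : ℝ) / 2 := by positivity
  have hG := Gamma_pos_of_pos hx
  have h1 := sq_Gamma_add_half_le hx
  have h2 := mul_sq_Gamma_le (show (1 : ℝ) / 2 < (d : ℝ) / 2 by linarith)
  rw [show (d : ℝ) / 2 + 1 / 2 = ((d : ℝ) + 1) / 2 by ring] at h1 h2
  have hnn : 0 ≤ gammaRatio d := by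
    have := Gamma_pos_of_pos (show (0 : ℝ) < ((d : ℝ) + 1) / 2 by positivity)
    unfold gammaRatio; positivity
  have hsq : gammaRatio d ^ 2
      = Gamma (((d : ℝ) + 1) / 2) ^ 2 / Gamma ((d : ℝ) / 2) ^ 2 * (2 / d) := by
    rw [gammaRatio, mul_pow, div_pow, Real.sq_sqrt (by positivity)]
  have hG2 : 0 < Gamma ((d : ℝ) / 2) ^ 2 := by positivity
  have u1 : gammaRatio d ^ 2 ≤ 1 := by
    rw [hsq]
    calc _ ≤ (d : ℝ) / 2 * (2 / d) :=
          mul_le_mul_of_nonneg_right (by rwa [div_le_iff₀ hG2]) (by positivity)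
      _ = 1 := by field_simp
  have u2 : 1 - 1 / (d : ℝ) ≤ gammaRatio d ^ 2 := by
    rw [hsq]
    calc 1 - 1 / (d : ℝ) = ((d : ℝ) / 2 - 1 / 2) * (2 / d) := by field_simp
      _ ≤ _ := mul_le_mul_of_nonneg_right (by rwa [le_div_iff₀ hG2]) (by positivity)
  -- For `0 ≤ g ≤ 1` one has `1 - g ≤ 1 - g² ≤ 1/d`, so no square root has to be expanded.
  have u3 : gammaRatio d ≤ 1 := by nlinarith
  rw [abs_sub_comm, abs_of_nonneg (by linarith)]
  nlinarith

theorem isBigO_gammaRatio_sub_one :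
    (fun d : ℕ => gammaRatio d - 1) =O[Filter.atTop] fun d : ℕ => 1 / (d : ℝ) := by
  refine Asymptotics.IsBigO.of_bound 1 ?_
  filter_upwards [Filter.eventually_gt_atTop 1] with d hd
  rw [one_mul, Real.norm_eq_abs, Real.norm_eq_abs, abs_of_nonneg (by positivity : (0 : ℝ) ≤ 1 / d)]
  exact abs_gammaRatio_sub_one_le hd

theorem isBigO_gammaRatio_mul_sub_one :
    (fun d : ℕ => gammaRatio d * (d / (d + 2)) - 1) =O[Filter.atTop] fun d : ℕ => 1 / (d : ℝ) := by
  refine Asymptotics.IsBigO.of_bound 3 ?_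
  filter_upwards [Filter.eventually_gt_atTop 1] with d hd
  have hd0 : (0 : ℝ) < d := by exact_mod_cast (zero_lt_one.trans hd)
  rw [Real.norm_eq_abs, Real.norm_eq_abs, abs_of_nonneg (by positivity : (0 : ℝ) ≤ 1 / d)]
  have h1 := abs_gammaRatio_sub_one_le hd
  have h2 : gammaRatio d * (d / (d + 2)) - 1
      = (gammaRatio d - 1) * ((d : ℝ) / (d + 2)) - 2 / (d + 2) := by
    field_simp; ring
  have h3 : |(gammaRatio d - 1) * ((d : ℝ) / (d + 2))| ≤ 1 / d := by
    rw [abs_mul, abs_of_nonneg (by positivity : (0 : ℝ) ≤ (d : ℝ) / (d + 2))]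
    refine (mul_le_of_le_one_right (abs_nonneg _) ?_).trans h1
    rw [div_le_one (by positivity)]; linarith
  have h4 : |(2 : ℝ) / (d + 2)| ≤ 2 * (1 / d) := by
    rw [abs_of_nonneg (by positivity), mul_one_div]
    gcongr; linarith
  rw [h2]
  exact (abs_sub _ _).trans (by linarith)

variable {d : ℕ}

/-- The leading constant: the sphere has area `d` times the volume of the unit ball, and this `d`
cancels the `1/d` of the second radial moment. -/
theorem szekelyConst_mul_volume (hd : 0 < d) :
    1 / (2 * szekelyConst d) * (volume : Measure (Vec d)).real (Metric.ball 0 1)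
      = 1 / √(2 * π * d) * gammaRatio d := by
  have : NeZero d := ⟨hd.ne'⟩
  have hd0 : (0 : ℝ) < d := by exact_mod_cast hd
  have hG := Gamma_pos_of_pos (show (0 : ℝ) < (d : ℝ) / 2 by positivity)
  have hG' := Gamma_pos_of_pos (show (0 : ℝ) < ((d : ℝ) + 1) / 2 by positivity)
  have hv : (volume : Measure (Vec d)).real (Metric.ball 0 1)
      = √π ^ d / ((d : ℝ) / 2 * Gamma ((d : ℝ) / 2)) := by
    rw [Measure.real, EuclideanSpace.volume_ball]
    simp only [ENNReal.ofReal_one, one_pow, one_mul, Fintype.card_fin]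
    rw [Real.Gamma_add_one (by positivity), ENNReal.toReal_ofReal (by positivity)]
  have hp : π ^ (((d : ℝ) + 1) / 2) = √π ^ d * √π := by
    rw [← pow_succ, Real.sqrt_eq_rpow, ← Real.rpow_natCast, ← Real.rpow_mul pi_pos.le]
    congr 1; push_cast; ring
  have hs : √(2 * π * d) = √2 * √π * √d := by
    rw [Real.sqrt_mul (by positivity), Real.sqrt_mul (by positivity)]
  have hs2 : √(2 / d) = √2 / √d := Real.sqrt_div (by norm_num) _
  have hdd : √(d : ℝ) * √d = d := Real.mul_self_sqrt hd0.le
  have hsd : 0 < √(d : ℝ) := Real.sqrt_pos.2 hd0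
  have hsp : 0 < √π := Real.sqrt_pos.2 pi_pos
  have hs2p : 0 < √(2 : ℝ) := Real.sqrt_pos.2 (by norm_num)
  rw [hv, szekelyConst, hp, gammaRatio, hs, hs2]
  nth_rewrite 1 [← hdd]
  field_simp
  rw [Real.sq_sqrt hd0.le]

/-! ### Reduction to one-dimensional integrals -/

section Radial

variable {k : ℝ → ℝ}

/-- Near `0` continuity suffices, and beyond `1` lower powers are dominated by the cube. -/
theorem integrableOn_mul_pow_of_cube (hk : Continuous k) (hk0 : ∀ r, 0 ≤ k r)
    (hint : IntegrableOn (fun r => k r * r ^ 3) (Ioi 0)) {n : ℕ} (hn : n ≤ 3) :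
    IntegrableOn (fun r => k r * r ^ n) (Ioi 0) := by
  rw [← Ioc_union_Ioi_eq_Ioi (zero_le_one' ℝ)]
  refine IntegrableOn.union ?_ ?_
  · exact (Continuous.integrableOn_Icc (by fun_prop)).mono_set Ioc_subset_Icc_self
  · refine (hint.mono_set (Ioi_subset_Ioi zero_le_one)).mono' (by fun_prop) ?_
    filter_upwards [ae_restrict_mem measurableSet_Ioi] with r hr
    have hr : 1 < r := hr
    rw [Real.norm_eq_abs, abs_of_nonneg (mul_nonneg (hk0 r) (by positivity))]
    exact mul_le_mul_of_nonneg_left (pow_le_pow_right₀ hr.le hn) (hk0 r)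

/-- The polar Jacobian `r ^ (d - 1)` against `r ^ (-(d + 1))` leaves `r ^ (-2)`, hence the shift of
the exponent by two. -/
theorem pow_smul_div_pow_mul_pow (hd : 0 < d) (n : ℕ) {r : ℝ} (hr : r ∈ Ioi (0 : ℝ)) :
    r ^ (Module.finrank ℝ (Vec d) - 1) • (k r / r ^ (d + 1) * r ^ (n + 2)) = k r * r ^ n := by
  have hr : 0 < r := hr
  obtain ⟨m, rfl⟩ := Nat.exists_eq_succ_of_ne_zero hd.ne'
  simp only [finrank_euclideanSpace, Fintype.card_fin, smul_eq_mul, Nat.succ_eq_add_one,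
    Nat.add_sub_cancel]
  rw [show r ^ (m + 1 + 1) = r ^ m * r ^ 2 by ring, show r ^ (n + 2) = r ^ n * r ^ 2 by ring]
  field_simp

theorem integrable_radial_iff (hd : 0 < d) (n : ℕ) :
    Integrable (fun ω : Vec d => k ‖ω‖ / ‖ω‖ ^ (d + 1) * ‖ω‖ ^ (n + 2))
      ↔ IntegrableOn (fun r => k r * r ^ n) (Ioi 0) := by
  have : NeZero d := ⟨hd.ne'⟩
  rw [integrable_fun_norm_addHaar (volume : Measure (Vec d))
    (f := fun r => k r / r ^ (d + 1) * r ^ (n + 2))]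
  exact integrableOn_congr_fun (fun r hr => pow_smul_div_pow_mul_pow hd n hr) measurableSet_Ioi

theorem integral_radial (hd : 0 < d) (n : ℕ) :
    ∫ ω : Vec d, k ‖ω‖ / ‖ω‖ ^ (d + 1) * ‖ω‖ ^ (n + 2)
      = d * (volume : Measure (Vec d)).real (Metric.ball 0 1) * ∫ r in Ioi (0 : ℝ), k r * r ^ n := by
  have : NeZero d := ⟨hd.ne'⟩
  rw [integral_fun_norm_addHaar (volume : Measure (Vec d))
    (fun r => k r / r ^ (d + 1) * r ^ (n + 2)),
    setIntegral_congr_fun measurableSet_Ioi fun r hr => pow_smul_div_pow_mul_pow hd n hr]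
  simp [mul_assoc]

end Radial

/-! ### The quartic form and its contractions -/

section Forms

variable (P Q : Measure (Vec d))

theorem covDiff_comm (i j : Fin d) : covDiff P Q i j = covDiff P Q j i := by
  simp only [covDiff, covMatrix, Matrix.sub_apply, Matrix.of_apply, mul_comm]

theorem skewDiff_rotate (i j k : Fin d) : skewDiff P Q i j k = skewDiff P Q j k i := by
  simp only [skewDiff, thirdCentralMoment]
  congr 2 <;> · funext x; ring

theorem skewDiff_swap (i j k : Fin d) : skewDiff P Q i j k = skewDiff P Q i k j := by
  simp only [skewDiff, thirdCentralMoment]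
  congr 2 <;> · funext x; ring

/-- The coefficients of the quartic form. -/
noncomputable def quarticCoeff (i j k l : Fin d) : ℝ :=
  covDiff P Q i j * covDiff P Q k l / 4 - skewDiff P Q i j k * meanDiff P Q l / 3
    - meanDiff P Q i * meanDiff P Q j * meanDiff P Q k * meanDiff P Q l / 12

theorem quarticForm_eq_sum (ω : Vec d) : quarticForm P Q ω
    = ∑ i, ∑ j, ∑ k, ∑ l, quarticCoeff P Q i j k l * (ω i * ω j * ω k * ω l) := by
  have hin : inner ℝ (meanDiff P Q) ω = ∑ i, meanDiff P Q i * ω i := by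
    rw [PiLp.inner_apply]; exact Finset.sum_congr rfl fun i _ => by simp [mul_comm]
  have h1 : covForm P Q ω ^ 2 / 4 = ∑ i, ∑ j, ∑ k, ∑ l,
      covDiff P Q i j * covDiff P Q k l / 4 * (ω i * ω j * ω k * ω l) := by
    rw [sq, covForm]
    simp only [Finset.sum_mul, Finset.mul_sum, Finset.sum_div]
    exact Finset.sum_congr rfl fun i _ => Finset.sum_congr rfl fun j _ =>
      Finset.sum_congr rfl fun k _ => Finset.sum_congr rfl fun l _ => by ring
  have h2 : inner ℝ (meanDiff P Q) ω * skewForm P Q ω / 3 = ∑ i, ∑ j, ∑ k, ∑ l,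
      skewDiff P Q i j k * meanDiff P Q l / 3 * (ω i * ω j * ω k * ω l) := by
    rw [hin, skewForm, mul_comm]
    simp only [Finset.sum_mul]
    simp only [Finset.mul_sum, Finset.sum_div]
    exact Finset.sum_congr rfl fun i _ => Finset.sum_congr rfl fun j _ =>
      Finset.sum_congr rfl fun k _ => Finset.sum_congr rfl fun l _ => by ring
  have h3 : inner ℝ (meanDiff P Q) ω ^ 4 / 12 = ∑ i, ∑ j, ∑ k, ∑ l,
      meanDiff P Q i * meanDiff P Q j * meanDiff P Q k * meanDiff P Q l / 12
        * (ω i * ω j * ω k * ω l) := by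
    rw [hin, show ∀ x : ℝ, x ^ 4 = x * (x * (x * x)) from fun x => by ring]
    simp only [Finset.sum_mul, Finset.mul_sum, Finset.sum_div]
    exact Finset.sum_congr rfl fun i _ => Finset.sum_congr rfl fun j _ =>
      Finset.sum_congr rfl fun k _ => Finset.sum_congr rfl fun l _ => by ring
  rw [quarticForm, h1, h2, h3]
  simp only [quarticCoeff, sub_mul, Finset.sum_sub_distrib]

/-- The three pairings of `Δ ⊗ Δ / 4` give `Tr(Δ)²/4` once and `‖Δ‖_F²/4` twice. By symmetry of `κ`
each pairing of `κ ⊗ μ / 3` gives `β·μ / 3`, and each pairing of the mean term gives `‖μ‖⁴/12`. -/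
theorem sum_quarticCoeff : ∑ i, ∑ j, (quarticCoeff P Q i i j j + quarticCoeff P Q i j i j
    + quarticCoeff P Q i j j i) = secondBracket P Q / 4 := by
  have hn : ‖meanDiff P Q‖ ^ 4
      = ∑ i, ∑ j, meanDiff P Q i ^ 2 * meanDiff P Q j ^ 2 := by
    rw [show ∀ x : ℝ, x ^ 4 = x ^ 2 * x ^ 2 from fun x => by ring, EuclideanSpace.real_norm_sq_eq,
      Finset.sum_mul_sum]
  have ht : (covDiff P Q).trace ^ 2 = ∑ i, ∑ j, covDiff P Q i i * covDiff P Q j j := by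
    rw [sq, Matrix.trace, Finset.sum_mul_sum]
    rfl
  have hb : betaDotMu P Q = ∑ i, ∑ j, skewDiff P Q i j j * meanDiff P Q i := by
    rw [betaDotMu, Finset.sum_comm]
    exact Finset.sum_congr rfl fun i _ => Finset.sum_congr rfl fun j _ => by
      rw [← skewDiff_rotate]
  have hsplit : secondBracket P Q / 4 = ∑ i, ∑ j,
      (covDiff P Q i j ^ 2 / 2 + covDiff P Q i i * covDiff P Q j j / 4
        - meanDiff P Q i ^ 2 * meanDiff P Q j ^ 2 / 4
        - skewDiff P Q i i j * meanDiff P Q j / 3 - skewDiff P Q i i j * meanDiff P Q j / 3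
        - skewDiff P Q i j j * meanDiff P Q i / 3) := by
    simp only [Finset.sum_add_distrib, Finset.sum_sub_distrib, ← Finset.sum_div]
    rw [← hb, ← hn, ← ht, ← betaDotMu, secondBracket]
    ring
  rw [hsplit]
  refine Finset.sum_congr rfl fun i _ => Finset.sum_congr rfl fun j _ => ?_
  simp only [quarticCoeff]
  rw [covDiff_comm P Q j i, skewDiff_swap P Q i j i]
  ring

end Forms

end EnergyDist

/-! ### Assembling the expansion -/

namespace EnergyDist

open MeasureTheory Real Set

variable {d : ℕ}

/-- The expansion of the energy distance for a radial weight `k(‖ω‖) = ‖φ_P(ω)‖ ‖φ_Q(ω)‖`, given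
the expansion of `‖f - 1‖² / ‖f‖` for `f = φ_P / φ_Q`. -/
theorem abs_energyDistSq_sub_le (hd : 0 < d) {P Q : Measure (Vec d)} [IsProbabilityMeasure P]
    [IsProbabilityMeasure Q] (hP : Integrable (fun x : Vec d => x) P)
    (hQ : Integrable (fun x : Vec d => x) Q) {f : Vec d → ℂ} (hf : ∀ ω, f ω ≠ 0)
    (hfPQ : ∀ ω, charFun P ω = charFun Q ω * f ω) {k : ℝ → ℝ} (hk : Continuous k)
    (hk0 : ∀ r, 0 ≤ k r) (hkPQ : ∀ ω : Vec d, ‖charFun P ω‖ * ‖charFun Q ω‖ = k ‖ω‖)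
    (hint : IntegrableOn (fun r => k r * r ^ 3) (Ioi 0)) {S : ℝ} (hS : 0 ≤ S)
    (hrem : ∫⁻ ω : Vec d, ENNReal.ofReal (k ‖ω‖ / ‖ω‖ ^ (d + 1) * |‖f ω - 1‖ ^ 2 / ‖f ω‖
        - (inner ℝ (meanDiff P Q) ω ^ 2 + quarticForm P Q ω)|) ≤ ENNReal.ofReal S) :
    |energyDistSq P Q -
      ((1 / √(2 * π * d)) * gammaRatio d * ‖meanDiff P Q‖ ^ 2 * (∫ r in Ioi (0 : ℝ), k r)
        + (1 / (4 * (d : ℝ))) * (1 / √(2 * π * d)) * (gammaRatio d * (d / (d + 2)))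
          * secondBracket P Q * (∫ r in Ioi (0 : ℝ), k r * r ^ 2))|
      ≤ 1 / (2 * szekelyConst d) * S := by
  have : NeZero d := ⟨hd.ne'⟩
  have hd0 : (0 : ℝ) < d := by exact_mod_cast hd
  have hc := szekelyConst_pos d
  obtain ⟨hI, hE⟩ := energyDistSq_eq_integral_charFun P Q hP hQ
  set w : ℝ → ℝ := fun r => k r / r ^ (d + 1) with hw
  have hwm : AEStronglyMeasurable (fun ω : Vec d => w ‖ω‖) volume := by
    refine Measurable.aestronglyMeasurable ?_
    exact ((hk.comp continuous_norm).measurable).div (by fun_prop)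
  have hF : ∀ ω : Vec d, ‖charFun P ω - charFun Q ω‖ ^ 2 / ‖ω‖ ^ (d + 1)
      = w ‖ω‖ * (‖f ω - 1‖ ^ 2 / ‖f ω‖) := by
    intro ω
    have hp : ‖f ω‖ ≠ 0 := norm_ne_zero_iff.2 (hf ω)
    have h1 : charFun P ω - charFun Q ω = charFun Q ω * (f ω - 1) := by rw [hfPQ]; ring
    simp only [hw]
    rw [h1, ← hkPQ, hfPQ, norm_mul, norm_mul]
    field_simp
  have J0 : IntegrableOn (fun r => k r * r ^ 0) (Ioi 0) :=
    integrableOn_mul_pow_of_cube hk hk0 hint (by norm_num)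
  have J2 : IntegrableOn (fun r => k r * r ^ 2) (Ioi 0) :=
    integrableOn_mul_pow_of_cube hk hk0 hint (by norm_num)
  have i2 : Integrable (fun ω : Vec d => w ‖ω‖ * ‖ω‖ ^ 2) := (integrable_radial_iff hd 0).2 J0
  have i4 : Integrable (fun ω : Vec d => w ‖ω‖ * ‖ω‖ ^ 4) := (integrable_radial_iff hd 2).2 J2
  have v2 := integral_radial (k := k) hd 0
  have v4 := integral_radial (k := k) hd 2
  have q2 : Integrable (fun ω : Vec d => w ‖ω‖ * inner ℝ (meanDiff P Q) ω ^ 2) :=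
    integrable_radial_mul_inner_pow hwm i2 _
  have u2 : ∫ ω : Vec d, w ‖ω‖ * inner ℝ (meanDiff P Q) ω ^ 2
      = ‖meanDiff P Q‖ ^ 2 / d * ∫ ω : Vec d, w ‖ω‖ * ‖ω‖ ^ 2 := by
    have h := integral_radial_mul_inner_mul_inner hwm i2 (meanDiff P Q) (meanDiff P Q)
    rw [real_inner_self_eq_norm_sq] at h
    simpa only [← sq] using h
  obtain ⟨q4, u4⟩ := integral_radial_mul_quartic hwm i4 (quarticCoeff P Q)
  simp only [← quarticForm_eq_sum, sum_quarticCoeff] at q4 u4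
  simp only [hF] at hI hE
  have hR : (∫ ω : Vec d, w ‖ω‖ * (‖f ω - 1‖ ^ 2 / ‖f ω‖))
      - ((∫ ω : Vec d, w ‖ω‖ * inner ℝ (meanDiff P Q) ω ^ 2)
        + ∫ ω : Vec d, w ‖ω‖ * quarticForm P Q ω)
      = ∫ ω : Vec d, w ‖ω‖ * (‖f ω - 1‖ ^ 2 / ‖f ω‖
        - (inner ℝ (meanDiff P Q) ω ^ 2 + quarticForm P Q ω)) := by
    rw [← integral_add q2 q4, ← integral_sub hI (by exact q2.add q4)]
    exact integral_congr_ae (Filter.Eventually.of_forall fun ω => by ring)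
  have hRle : |∫ ω : Vec d, w ‖ω‖ * (‖f ω - 1‖ ^ 2 / ‖f ω‖
        - (inner ℝ (meanDiff P Q) ω ^ 2 + quarticForm P Q ω))| ≤ S := by
    rw [← Real.norm_eq_abs, ← ENNReal.ofReal_le_ofReal_iff hS, ofReal_norm]
    refine (enorm_integral_le_lintegral_enorm _).trans (le_trans (le_of_eq ?_) hrem)
    refine lintegral_congr fun ω => ?_
    rw [← ofReal_norm, norm_mul, Real.norm_eq_abs, Real.norm_eq_abs,
      abs_of_nonneg (show 0 ≤ w ‖ω‖ from div_nonneg (hk0 _) (by positivity))]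
  have hV := szekelyConst_mul_volume hd
  set vol := (volume : Measure (Vec d)).real (Metric.ball 0 1)
  have hsame : (1 / √(2 * π * d)) * gammaRatio d * ‖meanDiff P Q‖ ^ 2 * (∫ r in Ioi (0 : ℝ), k r)
        + (1 / (4 * (d : ℝ))) * (1 / √(2 * π * d)) * (gammaRatio d * (d / (d + 2)))
          * secondBracket P Q * (∫ r in Ioi (0 : ℝ), k r * r ^ 2)
      = 1 / (2 * szekelyConst d) * ((∫ ω : Vec d, w ‖ω‖ * inner ℝ (meanDiff P Q) ω ^ 2)
        + ∫ ω : Vec d, w ‖ω‖ * quarticForm P Q ω) := by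
    rw [u2, u4, v2, v4]
    simp only [pow_zero, mul_one]
    -- The exact second coefficient carries `1 / (d + 2)`; the factor `d / (d + 2)` in `1 + ε₂`
    -- compensates for stating it with `1 / d`.
    have e1 : (1 / (4 * (d : ℝ))) * (1 / √(2 * π * d)) * (gammaRatio d * (d / (d + 2)))
        = (1 / √(2 * π * d) * gammaRatio d) * (1 / (4 * (d + 2))) := by field_simp
    rw [e1, ← hV]
    field_simp
  rw [hsame, hE, ← mul_sub, hR, abs_mul, abs_of_pos (show 0 < 1 / (2 * szekelyConst d) by positivity)]
  exact mul_le_mul_of_nonneg_left hRle (by positivity)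

theorem norm_exp_half_sq (z : ℂ) : ‖Complex.exp (z / 2)‖ ^ 2 = ‖Complex.exp z‖ := by
  rw [← norm_pow, sq, ← Complex.exp_add, add_halves]

end EnergyDist

open EnergyDist MeasureTheory in
theorem corollary1 :
    ∃ ε₁ ε₂ : ℕ → ℝ,
      ε₁ =O[Filter.atTop] (fun d : ℕ => 1 / (d : ℝ)) ∧
      ε₂ =O[Filter.atTop] (fun d : ℕ => 1 / (d : ℝ)) ∧
      ∀ (d : ℕ), 1 < d →
      ∀ (H : EnergyDist.Vec d → ℝ) (h : ℝ → ℝ) (B : ℝ → ℝ≥0) (b K : ℝ),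
        0 < b → b < 1 → (∀ ω, H ω = h ‖ω‖) →
      ∃ C : ℝ, 0 < C ∧
      ∀ (lam : ℝ), 0 < lam →
      ∀ (P Q : MeasureTheory.Measure (EnergyDist.Vec d)) (U V : EnergyDist.Vec d → ℂ),
        EnergyDist.Assumptions H B b K lam P Q U V →
        MeasureTheory.IntegrableOn h (Set.Ioi 0) ∧
        MeasureTheory.IntegrableOn (fun r => h r * r ^ 2) (Set.Ioi 0) ∧
        |EnergyDist.energyDistSq P Q -
          ((1 / lam) * (1 / Real.sqrt (2 * Real.pi * d)) * (1 + ε₁ d)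
              * ‖EnergyDist.meanDiff P Q‖ ^ 2 * (∫ r in Set.Ioi (0 : ℝ), h r)
            + (1 / lam ^ 3) * (1 / (4 * (d : ℝ))) * (1 / Real.sqrt (2 * Real.pi * d)) * (1 + ε₂ d)
              * EnergyDist.secondBracket P Q * (∫ r in Set.Ioi (0 : ℝ), h r * r ^ 2))|
          ≤ C / lam ^ (4 - b) := by
  refine ⟨fun d => gammaRatio d - 1, fun d => gammaRatio d * (d / (d + 2)) - 1,
    isBigO_gammaRatio_sub_one, isBigO_gammaRatio_mul_sub_one, ?_⟩
  intro d hd1 H h B b K _ _ hH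
  have hd : 0 < d := zero_lt_one.trans hd1
  obtain ⟨C, hC0, hC⟩ := exists_quotient_expansion hd B
  have hc := szekelyConst_pos d
  -- `K` may be negative or zero, so `|K|` and the added `1` keep the constant positive.
  refine ⟨1 / (2 * szekelyConst d) * (C * |K|) + 1, by positivity, ?_⟩
  intro lam hlam P Q U V hA
  have := hA.probP
  have := hA.probQ
  have hlp : 0 < lam ^ (4 - b) := Real.rpow_pos_of_pos hlam _
  set f : Vec d → ℂ := fun ω => Complex.exp (U ω - V ω) with hf
  have hfne : ∀ ω, f ω ≠ 0 := fun ω => Complex.exp_ne_zero _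
  have hfPQ : ∀ ω, charFun P ω = charFun Q ω * f ω := fun ω => by
    rw [hA.charP, hA.charQ, hf, ← Complex.exp_add]; congr 1; ring
  have hexp := hC P Q f (fun ω => Complex.exp (-(U ω - V ω))) hA.probP hA.probQ hA.momentP
    hA.momentQ hA.smooth_pos hA.smooth_neg hfPQ
    (fun ω => by simp only [hf]; rw [← Complex.exp_add, add_neg_cancel, Complex.exp_zero]) hA.bound
  have hHpq : ∀ ω, H (lam • ω) = ‖charFun P ω‖ * ‖charFun Q ω‖ := fun ω => by
    rw [← hA.decay, Htilde, norm_exp_half_sq, Complex.exp_add, norm_mul, hA.charP, hA.charQ]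
  set e : Vec d := EuclideanSpace.single ⟨0, hd⟩ 1 with he
  have he1 : ‖e‖ = 1 := by simp [he]
  -- `h` is arbitrary, with no regularity assumed; the product of characteristic functions along the
  -- line through `e` is a continuous function agreeing with `h(λr)` for `r ≥ 0`.
  set k : ℝ → ℝ := fun r => ‖charFun P (r • e)‖ * ‖charFun Q (r • e)‖ with hk
  have hkc : Continuous k :=
    ((continuous_charFun.comp (by fun_prop : Continuous fun r : ℝ => r • e)).norm).mul
      ((continuous_charFun.comp (by fun_prop : Continuous fun r : ℝ => r • e)).norm)
  have hk0 : ∀ r, 0 ≤ k r := fun r => by positivity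
  have hkh : ∀ r, 0 ≤ r → h (lam * r) = k r := fun r hr => by
    simp only [hk]
    rw [← hHpq, hH, norm_smul, norm_smul, he1, mul_one, Real.norm_eq_abs, Real.norm_eq_abs,
      abs_of_pos hlam, abs_of_nonneg hr]
  have hkω : ∀ ω : Vec d, H (lam • ω) = k ‖ω‖ := fun ω => by
    rw [← hkh _ (norm_nonneg ω), hH, norm_smul, Real.norm_eq_abs, abs_of_pos hlam]
  have hgrow : ∫⁻ ω : Vec d, ENNReal.ofReal (k ‖ω‖ / ‖ω‖ ^ (d + 1) * ‖ω‖ ^ 5 * (B ‖ω‖ : ℝ))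
      ≤ ENNReal.ofReal (K / lam ^ (4 - b)) := by
    simpa only [hkω] using hA.growth
  -- Since `f(0) = 1` forces `B ≥ 1`, the growth bound holds without the factor `B`; in polar
  -- coordinates it says that `k r * r ^ 3` is integrable.
  have hi5 : Integrable (fun ω : Vec d => k ‖ω‖ / ‖ω‖ ^ (d + 1) * ‖ω‖ ^ (3 + 2)) := by
    refine ⟨?_, ?_⟩
    · refine Measurable.aestronglyMeasurable (Measurable.mul ?_ (by fun_prop))
      exact ((hkc.comp continuous_norm).measurable).div (by fun_prop)
    · rw [hasFiniteIntegral_iff_ofReal (Filter.Eventually.of_forall fun ω =>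
        mul_nonneg (div_nonneg (hk0 _) (by positivity)) (by positivity))]
      refine lt_of_le_of_lt (lintegral_mono fun ω => ?_) (hgrow.trans_lt ENNReal.ofReal_lt_top)
      refine ENNReal.ofReal_le_ofReal (le_mul_of_one_le_right ?_ (hexp ω).1)
      exact mul_nonneg (div_nonneg (hk0 _) (by positivity)) (by positivity)
  have hint : IntegrableOn (fun r => k r * r ^ 3) (Set.Ioi 0) := (integrable_radial_iff hd 3).1 hi5
  -- The substitution `r ↦ λr` gives `λ` for the measure and `λ ^ n` for the power.
  have hscale : ∀ n : ℕ, n ≤ 3 → IntegrableOn (fun r => h r * r ^ n) (Set.Ioi 0) ∧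
      ∫ r in Set.Ioi (0 : ℝ), k r * r ^ n
        = 1 / lam ^ (n + 1) * ∫ r in Set.Ioi (0 : ℝ), h r * r ^ n := by
    intro n hn
    have hJ := integrableOn_mul_pow_of_cube hkc hk0 hint hn
    have hrel : Set.EqOn (fun r => h (lam * r) * (lam * r) ^ n)
        (fun r => lam ^ n * (k r * r ^ n)) (Set.Ioi 0) := fun r hr => by
      simp only [hkh r (le_of_lt hr)]; ring
    refine ⟨?_, ?_⟩
    · have h1 : IntegrableOn (fun r => h (lam * r) * (lam * r) ^ n) (Set.Ioi 0) :=
        (integrableOn_congr_fun hrel measurableSet_Ioi).2 (hJ.const_mul _)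
      simpa using (integrableOn_Ioi_comp_mul_left_iff (fun r => h r * r ^ n) 0 hlam).1 h1
    · have h2 := integral_comp_mul_left_Ioi (fun r => h r * r ^ n) 0 hlam
      rw [mul_zero, setIntegral_congr_fun measurableSet_Ioi hrel, integral_const_mul,
        smul_eq_mul] at h2
      have hl : lam ^ n ≠ 0 := by positivity
      rw [← mul_right_inj' hl, h2]
      field_simp
      ring
  obtain ⟨j0, w0⟩ := hscale 0 (by norm_num)
  obtain ⟨j2, w2⟩ := hscale 2 (by norm_num)
  simp only [pow_zero, mul_one, zero_add, pow_one] at j0 w0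
  refine ⟨j0, j2, ?_⟩
  have hrem : ∫⁻ ω : Vec d, ENNReal.ofReal (k ‖ω‖ / ‖ω‖ ^ (d + 1) * |‖f ω - 1‖ ^ 2 / ‖f ω‖
        - (inner ℝ (meanDiff P Q) ω ^ 2 + quarticForm P Q ω)|)
      ≤ ENNReal.ofReal (C * (|K| / lam ^ (4 - b))) := by
    calc _ ≤ ∫⁻ ω : Vec d, ENNReal.ofReal C
          * ENNReal.ofReal (k ‖ω‖ / ‖ω‖ ^ (d + 1) * ‖ω‖ ^ 5 * (B ‖ω‖ : ℝ)) := by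
          refine lintegral_mono fun ω => ?_
          rw [← ENNReal.ofReal_mul hC0]
          refine ENNReal.ofReal_le_ofReal ?_
          refine (mul_le_mul_of_nonneg_left (hexp ω).2
            (div_nonneg (hk0 _) (by positivity))).trans_eq ?_
          ring
      _ = ENNReal.ofReal C * ∫⁻ ω : Vec d,
            ENNReal.ofReal (k ‖ω‖ / ‖ω‖ ^ (d + 1) * ‖ω‖ ^ 5 * (B ‖ω‖ : ℝ)) :=
          lintegral_const_mul' _ _ ENNReal.ofReal_ne_top
      _ ≤ ENNReal.ofReal C * ENNReal.ofReal (|K| / lam ^ (4 - b)) := by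
          gcongr
          refine hgrow.trans (ENNReal.ofReal_le_ofReal ?_)
          gcongr
          exact le_abs_self K
      _ = _ := (ENNReal.ofReal_mul hC0).symm
  have hmain := abs_energyDistSq_sub_le hd (hA.momentP.integrable (by norm_num))
    (hA.momentQ.integrable (by norm_num)) hfne hfPQ hkc hk0
    (fun ω => by rw [← hHpq, hkω]) hint (by positivity) hrem
  rw [w0, w2] at hmain
  refine le_trans (le_of_eq ?_) (hmain.trans ?_)
  · congr 2
    ring
  · rw [le_div_iff₀ hlp]
    have : 1 / (2 * szekelyConst d) * (C * (|K| / lam ^ (4 - b))) * lam ^ (4 - b)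
        = 1 / (2 * szekelyConst d) * (C * |K|) := by field_simp
    rw [this]
    linarith
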